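/- A multidimensional arithmetic progression of dimension $d \ge 0$ in $\mathbb{Z}$ is a set of the form $$P=\{x_0+l_1x_1+\dots+l_dx_d : l_i\in\mathbb{Z},\ 0\le l_i<L_i \text{ for } 1\le i\le d\},$$ where $x_0,x_1,\dots,x_d\in\mathbb{Z}$ and $L_1,\dots,L_d\ge 1$ are integers (the sums need not be distinct); $|P|$ denotes its cardinality as a set. **Theorem 1.1.** There is an absolute constant $C>0$ such that the following holds. Let $A\subset\mathbb{Z}$ be a finite non-empty set and let $K$ be a real number with $|A+A|\le K|A|$. Then there are an integer $d\ge 0$ and a multidimensional arithmetic progression $P$ of dimension $d$ in $\mathbb{Z}$ such that $A\subset P$, $$d\le C K^{7/4}(\log K)^3\qquad\text{and}\qquad |P|\le \exp\left(C K^{7/4}(\log K)^3\right)|A|.$$ (The hypotheses imply $K\ge 1$.) -/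

import Mathlib

open scoped Pointwise

/-- The set `{x₀ + l₁ x₁ + ⋯ + l_d x_d : 0 ≤ lᵢ < Lᵢ}` of integers. The sums need not be distinct. -/
def multiProgression {d : ℕ} (x₀ : ℤ) (x : Fin d → ℤ) (L : Fin d → ℕ) : Finset ℤ :=
  (Fintype.piFinset fun i => Finset.range (L i)).image fun l => x₀ + ∑ i, (l i : ℤ) * x i

/-- `P` is a multidimensional arithmetic progression of dimension `d` in `ℤ`: it has a presentation
with base point `x₀`, `d` steps `xᵢ` and `d` lengths `Lᵢ ≥ 1`. -/
def IsMultiProgression (d : ℕ) (P : Finset ℤ) : Prop :=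
  ∃ (x₀ : ℤ) (x : Fin d → ℤ) (L : Fin d → ℕ),
    (∀ i, 1 ≤ L i) ∧ P = multiProgression x₀ x L

/-! The plan is to find a large progression `X` of dimension about `K^(3/4) log K` inside `4A - 4A`,
and then to cover `A` by few translates of `X - X`, arranged in a progression.

To find `X`, Ruzsa's modelling lemma (`exists_freiman_model`) replaces a positive proportion of `A`
by a dense set `B` in `ZMod N`, Freiman isomorphic of order 12. Sampling in `L⁴`
(`exists_almostPeriods`) gives `T ⊆ B` with `log (|B| / |T|)` about `K^(1/2) log K`, such that a
typical `b + b'` stays in `B + B` after a shift by any element of `2T - 2T`. In Fourier space the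
fourth power of the transform of `T` suppresses everything outside the spectrum at level `η` about
`K^(-1/8)`. So `4B - 4B` contains a Bohr set (`exists_bohr_subset`), whose rank is at most about
`η⁻² K^(1/2) log K`, that is `K^(3/4) log K`, by Chang's theorem. Minkowski's second theorem finds
in it a proper progression with one more dimension (`exists_progression_of_addChars`), and the
Freiman isomorphism carries it back to `4A - 4A` (`exists_lift_progression`).

In Chang's covering (`chang_covering`) the number `t` of rounds is at most about `log (|A| / |X|)`
up to terms in `log K`, hence about `K^(3/4) (log K)²`. Each round costs about `2K` dimensions, for
a total of order `K^(7/4) (log K)²`. The third logarithm in the statement is slack. -/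

namespace IsMultiProgression

theorem add {d e : ℕ} {P Q : Finset ℤ} (hP : IsMultiProgression d P)
    (hQ : IsMultiProgression e Q) : IsMultiProgression (d + e) (P + Q) := by
  obtain ⟨x₀, x, L, hL, rfl⟩ := hP
  obtain ⟨y₀, y, M, hM, rfl⟩ := hQ
  refine ⟨x₀ + y₀, Fin.append x y, Fin.append L M, ?_, ?_⟩
  · intro i
    refine Fin.addCases (fun i => ?_) (fun i => ?_) i
    · simpa using hL i
    · simpa using hM i
  · ext z
    simp only [multiProgression, Finset.mem_add, Finset.mem_image, Fintype.mem_piFinset,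
      Finset.mem_range]
    constructor
    · rintro ⟨_, ⟨l, hl, rfl⟩, _, ⟨m, hm, rfl⟩, rfl⟩
      refine ⟨Fin.append l m, fun i => ?_, ?_⟩
      · refine Fin.addCases (fun i => ?_) (fun i => ?_) i
        · simpa using hl i
        · simpa using hm i
      · rw [Fin.sum_univ_add]
        simp only [Fin.append_left, Fin.append_right]
        ring
    · rintro ⟨l, hl, rfl⟩
      refine ⟨_, ⟨fun i => l (Fin.castAdd e i), fun i => ?_, rfl⟩, _,
        ⟨fun i => l (Fin.natAdd d i), fun i => ?_, rfl⟩, ?_⟩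
      · simpa using hl (Fin.castAdd e i)
      · simpa using hl (Fin.natAdd d i)
      · rw [Fin.sum_univ_add]
        simp only [Fin.append_left, Fin.append_right]
        ring

end IsMultiProgression

/-! ### Progressions and Chang's covering argument. -/

theorem card_multiProgression_le {d : ℕ} (x₀ : ℤ) (x : Fin d → ℤ) (L : Fin d → ℕ) :
    (multiProgression x₀ x L).card ≤ ∏ i, L i := by
  refine Finset.card_image_le.trans ?_
  simp

/-- A set of at most `m` integers, together with its difference set, lies in a progression of
dimension `m` all of whose lengths are `3`. -/
theorem exists_multiProgression_of_card_le {R : Finset ℤ} {m : ℕ} (hR : R.card ≤ m) :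
    ∃ P, IsMultiProgression m P ∧ P.card ≤ 3 ^ m ∧ R ⊆ P ∧ R - R ⊆ P := by
  obtain ⟨r, hr⟩ : ∃ r : Fin m → ℤ, ∀ a ∈ R, ∃ i, r i = a := by
    refine ⟨fun i => if h : (i : ℕ) < R.card then R.equivFin.symm ⟨i, h⟩ else 0, fun a ha => ?_⟩
    refine ⟨⟨R.equivFin ⟨a, ha⟩, (Fin.is_lt _).trans_le hR⟩, ?_⟩
    simp
  -- With this base point the digits 0, 1, 2 stand for the coefficients -1, 0, 1.
  refine ⟨multiProgression (-∑ i, r i) r fun _ => 3, ⟨_, _, _, fun _ => by norm_num, rfl⟩, ?_, ?_, ?_⟩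
  · simpa using card_multiProgression_le (-∑ i, r i) r fun _ => 3
  · intro a ha
    obtain ⟨i, rfl⟩ := hr a ha
    refine Finset.mem_image.2 ⟨fun k => 1 + if k = i then 1 else 0, ?_, ?_⟩
    · simp only [Fintype.mem_piFinset, Finset.mem_range]
      intro k
      split_ifs <;> norm_num
    · simp [add_mul, Finset.sum_add_distrib]
  · intro z hz
    obtain ⟨a, ha, b, hb, rfl⟩ := Finset.mem_sub.1 hz
    obtain ⟨i, rfl⟩ := hr a ha
    obtain ⟨j, rfl⟩ := hr b hb
    -- The leading 1 keeps the natural subtraction from truncating.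
    refine Finset.mem_image.2 ⟨fun k => (1 + if k = i then 1 else 0) - if k = j then 1 else 0, ?_, ?_⟩
    · simp only [Fintype.mem_piFinset, Finset.mem_range]
      intro k
      split_ifs <;> norm_num
    · have h : ∀ k, (((1 + if k = i then 1 else 0) - if k = j then 1 else 0 : ℕ) : ℤ) * r k
          = r k + (if k = i then r k else 0) - (if k = j then r k else 0) := by
        intro k
        split_ifs <;> simp; ring
      simp only [h, Finset.sum_add_distrib, Finset.sum_sub_distrib]
      simp
      ring

/-- One step of Chang's covering argument. -/
theorem exists_cover_or_card_add_eq {G : Type*} [AddCommGroup G] [DecidableEq G] (A : Finset G)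
    {X : Finset G} (hX : X.Nonempty) (m : ℕ) :
    ∃ F ⊆ A, (F.card ≤ m ∧ A ⊆ F + (X - X)) ∨ (F.card = m ∧ (F + X).card = m * X.card) := by
  classical
  -- Take a maximal `F` with disjoint translates of `X`. If it is small, maximality makes every `a +
  -- X` meet some `b + X`; if it is large, any `m` of its translates are disjoint.
  set C := {F ∈ A.powerset | (SetLike.coe F).PairwiseDisjoint (· +ᵥ X)}
  obtain ⟨F, hFmax⟩ := C.exists_maximal <| Finset.filter_nonempty_iff.2
    ⟨∅, Finset.empty_mem_powerset _, by simp [Finset.coe_empty]⟩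
  simp only [C, Finset.mem_filter, Finset.mem_powerset] at hFmax
  obtain ⟨hFA, hF⟩ := hFmax.1
  rcases le_or_gt F.card m with hm | hm
  · refine ⟨F, hFA, .inl ⟨hm, fun a ha => ?_⟩⟩
    by_cases hau : a ∈ F
    · refine Finset.mem_add.2 ⟨a, hau, 0, ?_, add_zero a⟩
      obtain ⟨x, hx⟩ := hX
      exact Finset.mem_sub.2 ⟨x, hx, x, hx, sub_self x⟩
    by_cases! H : ∀ b ∈ F, Disjoint (a +ᵥ X) (b +ᵥ X)
    · refine (hFmax.not_gt ?_ <| Finset.ssubset_insert hau).elim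
      rw [Finset.insert_subset_iff, Finset.coe_insert]
      exact ⟨⟨ha, hFA⟩, hF.insert fun _ hb _ ↦ H _ hb⟩
    simp_rw [Finset.not_disjoint_iff, ← Finset.neg_vadd_mem_iff] at H
    obtain ⟨b, hb, c, hc₁, hc₂⟩ := H
    exact Finset.mem_add.2 ⟨b, hb, -b + a, Finset.mem_sub.2 ⟨_, hc₂, _, hc₁, by simp⟩, by simp⟩
  · obtain ⟨E, hE, hEm⟩ := Finset.exists_subset_card_eq hm.le
    refine ⟨E, hE.trans hFA, .inr ⟨hEm, ?_⟩⟩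
    rw [← hEm, Finset.card_add_iff.2]
    exact Finset.pairwiseDisjoint_vadd_iff.1 (hF.subset (by exact_mod_cast hE))

/-- **Chang's covering lemma**. -/
theorem chang_covering {A X : Finset ℤ} (hX : X.Nonempty) {K M : ℝ} (hK : 0 < K)
    (hM : ∀ t : ℕ, ((t • A + X).card : ℝ) ≤ K ^ t * M) {m : ℕ} (hm : 2 * K ≤ m) :
    ∃ (t : ℕ) (P : Finset ℤ), 2 ^ t * (X.card : ℝ) ≤ M ∧ IsMultiProgression (m * (t + 1)) P ∧
      P.card ≤ 3 ^ (m * (t + 1)) ∧ A ⊆ P + (X - X) := by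
  classical
  -- `good t` records `t` rounds of growth by a factor `m ≥ 2K`. Since `t • A + X` grows only by `K`
  -- per round, each round gains a factor 2 and the process must stop.
  let good : ℕ → Prop := fun t => ∃ Y P : Finset ℤ, Y.card = m ^ t * X.card ∧ Y ⊆ t • A + X ∧
    IsMultiProgression (m * t) P ∧ P.card ≤ 3 ^ (m * t) ∧ Y - Y ⊆ P + (X - X)
  have hbound : ∀ t, good t → 2 ^ t * (X.card : ℝ) ≤ M := by
    rintro t ⟨Y, P, hY, hYX, -⟩
    have h1 : (Y.card : ℝ) ≤ K ^ t * M :=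
      (Nat.cast_le.2 (Finset.card_le_card hYX)).trans (hM t)
    rw [hY] at h1
    push_cast at h1
    have h2 : (2 * K) ^ t * (X.card : ℝ) ≤ (m : ℝ) ^ t * X.card := by gcongr
    rw [mul_pow] at h2
    have h3 : K ^ t * (2 ^ t * (X.card : ℝ)) ≤ K ^ t * M := by linarith
    exact le_of_mul_le_mul_left h3 (by positivity)
  have hXc : (1 : ℝ) ≤ X.card := by exact_mod_cast hX.card_pos
  have hfin : ∃ t, good t ∧ ¬ good (t + 1) := by
    by_contra! hcon
    have h0 : good 0 := by
      refine ⟨X, {0}, by simp, by simp, ⟨0, Fin.elim0, Fin.elim0, fun i => i.elim0, ?_⟩,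
        by simp, (zero_add (X - X)).ge⟩
      simp [multiProgression]
    have hall : ∀ t, good t := fun t => Nat.rec h0 (fun t ht => hcon t ht) t
    obtain ⟨t, ht⟩ := pow_unbounded_of_one_lt M (one_lt_two : (1 : ℝ) < 2)
    have := hbound t (hall t)
    have h2 : (2 : ℝ) ^ t * 1 ≤ 2 ^ t * X.card := by gcongr
    linarith
  obtain ⟨t, ht, ht'⟩ := hfin
  have htM := hbound t ht
  obtain ⟨Y, P, hY, hYX, hP, hPc, hYP⟩ := ht
  have hmpos : 0 < m := by
    have : (0 : ℝ) < m := by linarith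
    exact_mod_cast this
  have hYne : Y.Nonempty := by
    rw [← Finset.card_pos, hY]
    have := hX.card_pos
    positivity
  obtain ⟨F, hFA, ⟨hFm, hAF⟩ | ⟨hFm, hFY⟩⟩ := exists_cover_or_card_add_eq A hYne m
  · obtain ⟨R, hR, hRc, hFR, -⟩ := exists_multiProgression_of_card_le hFm
    refine ⟨t, R + P, htM, ?_, ?_, ?_⟩
    · convert hR.add hP using 1
      ring
    · calc (R + P).card ≤ R.card * P.card := Finset.card_add_le
        _ ≤ 3 ^ m * 3 ^ (m * t) := Nat.mul_le_mul hRc hPc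
        _ = _ := by rw [← pow_add]; ring_nf
    · refine hAF.trans ?_
      rw [add_assoc]
      exact Finset.add_subset_add hFR hYP
  -- Disjoint translates would give one more round, contrary to the choice of `t`.
  · refine absurd ?_ ht'
    obtain ⟨R, hR, hRc, -, hFR⟩ := exists_multiProgression_of_card_le hFm.le
    refine ⟨F + Y, R + P, ?_, ?_, ?_, ?_, ?_⟩
    · rw [hFY, hY, pow_succ]; ring
    · rw [succ_nsmul', add_assoc]
      exact Finset.add_subset_add hFA hYX
    · convert hR.add hP using 1
      ring
    · calc (R + P).card ≤ R.card * P.card := Finset.card_add_le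
        _ ≤ 3 ^ m * 3 ^ (m * t) := Nat.mul_le_mul hRc hPc
        _ = _ := by rw [← pow_add]; ring_nf
    · rw [add_sub_add_comm, add_assoc]
      exact Finset.add_subset_add hFR hYP

/-! ### Moments of sums of independent samples. -/

theorem Fin.sum_univ_fun_succ {ι M : Type*} [Fintype ι] [AddCommMonoid M] (k : ℕ)
    (F : (Fin (k + 1) → ι) → M) :
    ∑ b, F b = ∑ a, ∑ b : Fin k → ι, F (Fin.cons a b) := by
  rw [← (Fin.consEquiv fun _ => ι).sum_comp, Fintype.sum_prod_type]
  rfl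

section Moments

variable {ι : Type*} [Fintype ι] {Z : ι → ℝ}

theorem sum_sum_fun_eq_zero (hZ : ∑ a, Z a = 0) (k : ℕ) :
    ∑ b : Fin k → ι, ∑ i, Z (b i) = 0 := by
  induction k with
  | zero => simp
  | succ k ih =>
    rw [Fin.sum_univ_fun_succ]
    simp only [Fin.sum_univ_succ, Fin.cons_zero, Fin.cons_succ, Finset.sum_add_distrib, ih]
    simp [← Finset.mul_sum, hZ]

/-- Splitting off one coordinate, the cross term vanishes by centring. The factor `Fintype.card ι`
on the left avoids an exponent `k - 1`. -/
theorem sum_sum_fun_sq (hZ : ∑ a, Z a = 0) (k : ℕ) :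
    Fintype.card ι * ∑ b : Fin k → ι, (∑ i, Z (b i)) ^ 2
      = k * Fintype.card ι ^ k * ∑ a, Z a ^ 2 := by
  induction k with
  | zero => simp
  | succ k ih =>
    rw [Fin.sum_univ_fun_succ]
    simp only [Fin.sum_univ_succ, Fin.cons_zero, Fin.cons_succ, add_sq, Finset.sum_add_distrib,
      ← Finset.mul_sum, sum_sum_fun_eq_zero hZ]
    simp only [Finset.sum_const, Finset.card_univ, nsmul_eq_mul, mul_zero, Fintype.card_fun,
      Fintype.card_fin, ← Finset.mul_sum, Nat.cast_pow]
    rw [mul_add, mul_left_comm, ih]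
    push_cast
    ring

/-- A fourth moment bound for sums of independent centred random variables bounded by `1`. -/
theorem sum_sum_fun_pow_four_le (hZ : ∑ a, Z a = 0) (hZ1 : ∀ a, |Z a| ≤ 1) (k : ℕ) :
    Fintype.card ι * ∑ b : Fin k → ι, (∑ i, Z (b i)) ^ 4
      ≤ 3 * k ^ 2 * Fintype.card ι ^ k * ∑ a, Z a ^ 2 := by
  have h4 : ∑ a, Z a ^ 4 ≤ ∑ a, Z a ^ 2 := Finset.sum_le_sum fun a _ => by
    have : Z a ^ 2 ≤ 1 := (sq_le_one_iff_abs_le_one _).2 (hZ1 a)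
    nlinarith [sq_nonneg (Z a)]
  have h2 : ∑ a, Z a ^ 2 ≤ Fintype.card ι := by
    calc ∑ a, Z a ^ 2 ≤ ∑ _a : ι, (1 : ℝ) :=
          Finset.sum_le_sum fun a _ => (sq_le_one_iff_abs_le_one _).2 (hZ1 a)
      _ = _ := by simp
  have h0 : 0 ≤ ∑ a, Z a ^ 2 := Finset.sum_nonneg fun a _ => sq_nonneg _
  induction k with
  | zero => simp
  | succ k ih =>
    rw [Fin.sum_univ_fun_succ]
    have hexp : ∀ x y : ℝ, (x + y) ^ 4 = x ^ 4 + 4 * (x ^ 3 * y) + 6 * (x ^ 2 * y ^ 2)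
        + 4 * (x * y ^ 3) + y ^ 4 := fun x y => by ring
    simp only [Fin.sum_univ_succ, Fin.cons_zero, Fin.cons_succ, hexp, Finset.sum_add_distrib,
      ← Finset.mul_sum, sum_sum_fun_eq_zero hZ]
    simp only [Finset.sum_const, Finset.card_univ, nsmul_eq_mul, mul_zero, Fintype.card_fun,
      Fintype.card_fin, ← Finset.mul_sum, ← Finset.sum_mul, Nat.cast_pow, hZ, zero_mul, add_zero]
    have hsq := sum_sum_fun_sq hZ k
    set n : ℝ := (Fintype.card ι : ℝ)
    set V := ∑ a, Z a ^ 2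
    set W := ∑ b : Fin k → ι, (∑ i, Z (b i)) ^ 4
    have hn : 0 ≤ n := Nat.cast_nonneg _
    calc _ = n ^ (k + 1) * ∑ a, Z a ^ 4 + 6 * V * (n * ∑ b : Fin k → ι, (∑ i, Z (b i)) ^ 2)
          + n * (n * W) := by ring
      _ ≤ n ^ (k + 1) * V + 6 * V * (k * n ^ k * n) + n * (3 * k ^ 2 * n ^ k * V) := by
        rw [hsq]
        gcongr
      _ ≤ _ := by
        have : 0 ≤ n ^ (k + 1) * V := by positivity
        rw [← sub_nonneg]
        -- The slack is `3(k+1)² - (3k² + 6k + 1) = 2`.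
        calc (0 : ℝ) ≤ 2 * (n ^ (k + 1) * V) := by positivity
          _ = _ := by push_cast; ring

end Moments

/-! ### Almost periods of a sumset by random sampling. -/

section AlmostPeriods

variable {G : Type*} [AddCommGroup G] [DecidableEq G]

theorem sum_indicator_add_right [Fintype G] (S : Finset G) (b : G) :
    ∑ x, (if x + b ∈ S then (1 : ℝ) else 0) = S.card := by
  refine (Equiv.sum_comp (Equiv.addRight b) fun x => if x ∈ S then (1 : ℝ) else 0).trans ?_
  simp

/-- The density of `S` on the translate `x + B`. -/
noncomputable def translateDensity (B S : Finset G) (x : G) : ℝ :=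
  (∑ b : B, if x + b ∈ S then (1 : ℝ) else 0) / B.card

variable {B S : Finset G}

theorem translateDensity_nonneg (x : G) : 0 ≤ translateDensity B S x :=
  div_nonneg (Finset.sum_nonneg fun _ _ => by split_ifs <;> norm_num) (Nat.cast_nonneg _)

theorem translateDensity_le_one (x : G) : translateDensity B S x ≤ 1 := by
  refine div_le_one_of_le₀ ?_ (Nat.cast_nonneg _)
  calc _ ≤ ∑ _b : B, (1 : ℝ) := Finset.sum_le_sum fun _ _ => by split_ifs <;> norm_num
    _ = _ := by simp

variable [Fintype G]

theorem sum_translateDensity (hB : B.Nonempty) : ∑ x, translateDensity B S x = S.card := by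
  have hB' : (B.card : ℝ) ≠ 0 := by exact_mod_cast hB.card_pos.ne'
  unfold translateDensity
  rw [← Finset.sum_div, Finset.sum_comm]
  simp only [sum_indicator_add_right]
  simp [mul_div_cancel_left₀ _ hB']

/-- Most samples of `k` elements of `B` approximate the density of `S` on translates of `B`
in the `L⁴` norm. -/
theorem exists_samples (hB : B.Nonempty) {k : ℕ} (hk : 0 < k) :
    ∃ Λ : Finset (Fin k → B), (B.card : ℝ) ^ k ≤ 2 * Λ.card ∧ ∀ b ∈ Λ,
      ∑ x, ((∑ i, if x + (b i : G) ∈ S then (1 : ℝ) else 0) / k - translateDensity B S x) ^ 4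
        ≤ 6 * S.card / k ^ 2 := by
  classical
  have hB' : (0 : ℝ) < B.card := by exact_mod_cast hB.card_pos
  have hk' : (0 : ℝ) < k := by exact_mod_cast hk
  set f := translateDensity B S
  let E : (Fin k → B) → ℝ := fun b =>
    ∑ x, ((∑ i, if x + (b i : G) ∈ S then (1 : ℝ) else 0) / k - f x) ^ 4
  have hE0 : ∀ b, 0 ≤ E b := fun b => Finset.sum_nonneg fun x _ => by positivity
  have hx : ∀ x, ∑ b : Fin k → B, ((∑ i, if x + (b i : G) ∈ S then (1 : ℝ) else 0) / k - f x) ^ 4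
      ≤ 3 * B.card ^ k / k ^ 2 * f x := by
    intro x
    let Z : B → ℝ := fun b => (if x + b ∈ S then (1 : ℝ) else 0) - f x
    have hf0 : 0 ≤ f x := translateDensity_nonneg x
    have hf1 : f x ≤ 1 := translateDensity_le_one x
    have hsum : ∑ b : B, (if x + b ∈ S then (1 : ℝ) else 0) = B.card * f x := by
      simp only [f, translateDensity]
      field_simp
    have hZ : ∑ b, Z b = 0 := by
      simp only [Z, Finset.sum_sub_distrib, hsum]
      simp
    have hZ1 : ∀ b, |Z b| ≤ 1 := by
      intro b
      simp only [Z]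
      split_ifs <;> rw [abs_le] <;> constructor <;> linarith
    -- Keeping the factor `f x` of the variance `f(1 - f)` makes the sum over `x` cost `|S|` rather
    -- than `|G|`.
    have hZ2 : ∑ b, Z b ^ 2 ≤ B.card * f x := by
      calc ∑ b, Z b ^ 2 ≤ ∑ b : B, ((if x + b ∈ S then (1 : ℝ) else 0) * (1 - 2 * f x) + f x ^ 2) := by
            refine Finset.sum_le_sum fun b _ => ?_
            simp only [Z]
            split_ifs <;> nlinarith
        _ = B.card * f x * (1 - f x) := by
            rw [Finset.sum_add_distrib, ← Finset.sum_mul, hsum]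
            simp
            ring
        _ ≤ _ := mul_le_of_le_one_right (by positivity) (by linarith)
    have hmom := sum_sum_fun_pow_four_le hZ hZ1 k
    rw [Fintype.card_coe] at hmom
    have hrw : ∀ b : Fin k → B, ((∑ i, if x + (b i : G) ∈ S then (1 : ℝ) else 0) / k - f x) ^ 4
        = (∑ i, Z (b i)) ^ 4 / k ^ 4 := by
      intro b
      rw [← div_pow]
      congr 1
      simp only [Z, Finset.sum_sub_distrib]
      simp
      field_simp
    simp only [hrw, ← Finset.sum_div]
    rw [div_le_iff₀ (by positivity)]
    refine le_of_mul_le_mul_left ?_ hB'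
    refine hmom.trans ?_
    calc 3 * (k : ℝ) ^ 2 * B.card ^ k * ∑ a, Z a ^ 2
        ≤ 3 * (k : ℝ) ^ 2 * B.card ^ k * (B.card * f x) := by gcongr
      _ = _ := by field_simp
  have htot : ∑ b, E b ≤ 3 * B.card ^ k / k ^ 2 * S.card := by
    simp only [E]
    rw [Finset.sum_comm, ← sum_translateDensity (S := S) hB, Finset.mul_sum]
    exact Finset.sum_le_sum fun x _ => hx x
  -- Markov's inequality below divides by the threshold, which is zero when `S` is empty.
  rcases S.eq_empty_or_nonempty with rfl | hS
  · refine ⟨Finset.univ, ?_, fun b _ => ?_⟩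
    · simp
      nlinarith [pow_pos hB' k]
    · simp [f, translateDensity]
  have hS' : (0 : ℝ) < S.card := by exact_mod_cast hS.card_pos
  -- The threshold is twice the bound on the mean, so at least half of the samples pass.
  refine ⟨Finset.univ.filter fun b => E b ≤ 6 * S.card / k ^ 2, ?_, fun b hb => (Finset.mem_filter.1 hb).2⟩
  have hmark : 6 * S.card / k ^ 2 * (({b | ¬ E b ≤ 6 * S.card / k ^ 2} : Finset (Fin k → B)).card : ℝ)
      ≤ ∑ b, E b := by
    calc _ = ∑ b ∈ ({b | ¬ E b ≤ 6 * S.card / k ^ 2} : Finset (Fin k → B)),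
          6 * (S.card : ℝ) / k ^ 2 := by simp; ring
      _ ≤ ∑ b ∈ ({b | ¬ E b ≤ 6 * S.card / k ^ 2} : Finset (Fin k → B)), E b :=
          Finset.sum_le_sum fun b hb => (not_le.1 (Finset.mem_filter.1 hb).2).le
      _ ≤ _ := Finset.sum_le_sum_of_subset_of_nonneg (Finset.subset_univ _) fun b _ _ => hE0 b
  have hcount := Finset.card_filter_add_card_filter_not (s := (Finset.univ : Finset (Fin k → B)))
    (fun b => E b ≤ 6 * S.card / k ^ 2)
  simp only [Finset.card_univ, Fintype.card_fun, Fintype.card_coe, Fintype.card_fin] at hcount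
  have hcount' : (({b | E b ≤ 6 * S.card / k ^ 2} : Finset (Fin k → B)).card : ℝ)
      + (({b | ¬ E b ≤ 6 * S.card / k ^ 2} : Finset (Fin k → B)).card : ℝ) = B.card ^ k := by
    exact_mod_cast hcount
  have h3 := hmark.trans htot
  have h4 : 3 * (B.card : ℝ) ^ k / k ^ 2 * S.card = 6 * S.card / k ^ 2 * (B.card ^ k / 2) := by ring
  rw [h4] at h3
  have h5 := le_of_mul_le_mul_left h3 (by positivity)
  linarith

/-- `L⁴` almost periodicity in the style of Croot and Sisask. -/
theorem exists_almostPeriods (hB : B.Nonempty) {K : ℝ} (hK : ((B + B).card : ℝ) ≤ K * B.card)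
    {k : ℕ} (hk : 0 < k) (hkK : 24576 * K ≤ k ^ 2) :
    ∃ T ⊆ B, (B.card : ℝ) ≤ 2 * K ^ k * T.card ∧
      ∀ t₁ ∈ T, ∀ t₂ ∈ T, ∀ t₃ ∈ T, ∀ t₄ ∈ T,
        (B.card : ℝ) ^ 2 ≤ 2 * ∑ b ∈ B, ∑ b' ∈ B,
          if b + b' + (t₁ + t₂ - t₃ - t₄) ∈ B + B then (1 : ℝ) else 0 := by
  classical
  have hB' : (0 : ℝ) < B.card := by exact_mod_cast hB.card_pos
  have hk' : (0 : ℝ) < k := by exact_mod_cast hk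
  set S := B + B
  have hS : S.Nonempty := hB.add hB
  have hS' : (0 : ℝ) < S.card := by exact_mod_cast hS.card_pos
  set f := translateDensity B S
  obtain ⟨Λ, hΛ, hΛE⟩ := exists_samples (S := S) hB hk
  -- Pigeonhole: the tuples `b + t` with `b ∈ Λ`, `t ∈ B` all lie in `S^k`, which has at most `K^k
  -- |B|^k` elements. In the fibre over `c`, `t` determines `b`.
  obtain ⟨c, hc⟩ : ∃ c : Fin k → G, (B.card : ℝ) ≤ 2 * K ^ k *
      ((B.filter fun t => ∃ b ∈ Λ, ∀ i, (b i : G) + t = c i).card : ℝ) := by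
    have hmaps : ∀ p ∈ Λ ×ˢ B, (fun i => (p.1 i : G) + p.2) ∈ Fintype.piFinset fun _ : Fin k => S := by
      intro p hp
      rw [Fintype.mem_piFinset]
      exact fun i => Finset.add_mem_add (p.1 i).2 (Finset.mem_product.1 hp).2
    have hcard : ((Fintype.piFinset fun _ : Fin k => S).card : ℝ) = S.card ^ k := by simp
    obtain ⟨c, -, hc⟩ := Finset.exists_le_card_fiber_of_nsmul_le_card_of_maps_to
      (b := (Λ.card * B.card : ℝ) / S.card ^ k) hmaps
      (Fintype.piFinset_nonempty.2 fun _ => hS) (by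
        rw [nsmul_eq_mul, hcard, Finset.card_product]
        push_cast
        rw [mul_div_cancel₀]
        positivity)
    refine ⟨c, ?_⟩
    have hle : (({p ∈ Λ ×ˢ B | (fun i => (p.1 i : G) + p.2) = c}).card : ℝ) ≤
        ((B.filter fun t => ∃ b ∈ Λ, ∀ i, (b i : G) + t = c i).card : ℝ) := by
      refine Nat.cast_le.2 (Finset.card_le_card_of_injOn Prod.snd ?_ ?_)
      · rintro ⟨b, t⟩ hp
        simp only [Finset.coe_filter, Finset.mem_product, Set.mem_ofPred_eq] at hp ⊢
        exact ⟨hp.1.2, b, hp.1.1, fun i => congrFun hp.2 i⟩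
      · rintro ⟨b, t⟩ hp ⟨b', t'⟩ hp' (rfl : t = t')
        simp only [Finset.coe_filter, Finset.mem_product, Set.mem_ofPred_eq] at hp hp'
        refine Prod.ext (funext fun i => Subtype.ext ?_) rfl
        have := congrFun (hp.2.trans hp'.2.symm) i
        simpa using this
    have h1 := hc.trans hle
    rw [div_le_iff₀ (by positivity)] at h1
    have hSK : (S.card : ℝ) ^ k ≤ K ^ k * B.card ^ k := by
      rw [← mul_pow]
      gcongr
    set τ : ℝ := ((B.filter fun t => ∃ b ∈ Λ, ∀ i, (b i : G) + t = c i).card : ℝ)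
    have hτ : 0 ≤ τ := Nat.cast_nonneg _
    have h2 : (B.card : ℝ) ^ k * B.card ≤ B.card ^ k * (2 * K ^ k * τ) := by
      calc (B.card : ℝ) ^ k * B.card ≤ 2 * Λ.card * B.card := by gcongr
        _ = 2 * (Λ.card * B.card) := by ring
        _ ≤ 2 * (τ * S.card ^ k) := by gcongr
        _ ≤ 2 * (τ * (K ^ k * B.card ^ k)) := by gcongr
        _ = _ := by ring
    exact le_of_mul_le_mul_left h2 (by positivity)
  refine ⟨B.filter fun t => ∃ b ∈ Λ, ∀ i, (b i : G) + t = c i, Finset.filter_subset _ _, hc, ?_⟩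
  -- `F` does not depend on `t`, yet approximates `f (· + t)` for every chosen `t`, since `c = b +
  -- t` with `b` a good sample.
  set F : G → ℝ := fun x => (∑ i, if x + c i ∈ S then (1 : ℝ) else 0) / k
  set δ : ℝ := 6 * S.card / k ^ 2
  have hF : ∀ t ∈ B.filter fun t => ∃ b ∈ Λ, ∀ i, (b i : G) + t = c i, ∀ w,
      ∑ x, (F (x + w) - f (x + w + t)) ^ 4 ≤ δ := by
    intro t ht w
    obtain ⟨-, b, hb, hbt⟩ := Finset.mem_filter.1 ht
    rw [← Equiv.sum_comp (Equiv.addRight (-t - w)) fun x => (F (x + w) - f (x + w + t)) ^ 4]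
    refine le_trans (le_of_eq (Finset.sum_congr rfl fun x _ => ?_)) (hΛE b hb)
    have e₁ : ∀ i, x + (-t - w) + w + (↑(b i) + t) = x + b i := fun i => by abel
    have e₂ : x + (-t - w) + w + t = x := by abel
    simp only [F, f, Equiv.coe_addRight, ← hbt, e₁, e₂]
  intro t₁ h₁ t₂ h₂ t₃ h₃ t₄ h₄
  set u := t₁ + t₂ - t₃ - t₄
  have hpow : ∀ p q r s : ℝ, (p - q + (r - s)) ^ 4 ≤ 64 * (p ^ 4 + q ^ 4 + r ^ 4 + s ^ 4) := by
    have h : ∀ a b : ℝ, (a + b) ^ 4 ≤ 8 * (a ^ 4 + b ^ 4) := by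
      intro a b
      nlinarith [sq_nonneg (a - b), sq_nonneg (a + b), sq_nonneg (a ^ 2 - b ^ 2),
        mul_nonneg (sq_nonneg (a - b)) (sq_nonneg (a + b)), sq_nonneg ((a - b) ^ 2),
        mul_nonneg (sq_nonneg (a - b)) (sq_nonneg a), mul_nonneg (sq_nonneg (a - b)) (sq_nonneg b)]
    intro p q r s
    have h1 := h (p - q) (r - s)
    have h2 := h p (-q)
    have h3 := h r (-s)
    have e1 : (-q) ^ 4 = q ^ 4 := by ring
    have e2 : (-s) ^ 4 = s ^ 4 := by ring
    rw [e1, ← sub_eq_add_neg] at h2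
    rw [e2, ← sub_eq_add_neg] at h3
    linarith
  -- Pass from `f (x + u)` to `f (x + t₁ - t₃)` and then to `f x`, comparing with `F` twice at each
  -- stage.
  have hu : ∑ x, (f x - f (x + u)) ^ 4 ≤ 256 * δ := by
    calc ∑ x, (f x - f (x + u)) ^ 4
        ≤ ∑ x, 64 * ((F (x + (t₁ - t₃ - t₄)) - f (x + (t₁ - t₃ - t₄) + t₂)) ^ 4
          + (F (x + (t₁ - t₃ - t₄)) - f (x + (t₁ - t₃ - t₄) + t₄)) ^ 4
          + (F (x + -t₃) - f (x + -t₃ + t₁)) ^ 4 + (F (x + -t₃) - f (x + -t₃ + t₃)) ^ 4) := by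
          refine Finset.sum_le_sum fun x _ => le_trans (le_of_eq ?_) (hpow _ _ _ _)
          rw [show x + (t₁ - t₃ - t₄) + t₂ = x + u by simp only [u]; abel,
            show x + (t₁ - t₃ - t₄) + t₄ = x + -t₃ + t₁ by abel,
            show x + -t₃ + t₃ = x by abel]
          ring
      _ ≤ 64 * (δ + δ + δ + δ) := by
          rw [← Finset.mul_sum]
          simp only [Finset.sum_add_distrib]
          gcongr
          · exact hF t₂ h₂ _
          · exact hF t₄ h₄ _
          · exact hF t₁ h₁ _
          · exact hF t₃ h₃ _
      _ = _ := by ring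
  have hfB : ∀ x ∈ B, f x = 1 := by
    intro x hx
    have : ∀ b : B, x + b ∈ S := fun b => Finset.add_mem_add hx b.2
    simp only [f, translateDensity, this, if_true]
    simp [hB'.ne']
  -- Hölder on `B`, where `f = 1`. The constant 24576 is `16 * 256 * 6`, which makes the mean
  -- deviation at most 1/2.
  have hsum4 : (∑ x ∈ B, (1 - f (x + u))) ^ 4 ≤ (B.card / 2 : ℝ) ^ 4 := by
    have hh : (∑ x ∈ B, (1 - f (x + u))) ^ 4 ≤ (B.card : ℝ) ^ 3 * ∑ x ∈ B, (1 - f (x + u)) ^ 4 := by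
      set g : G → ℝ := fun x => 1 - f (x + u)
      have h1 := sq_sum_le_card_mul_sum_sq (s := B) (f := g)
      have h2 := sq_sum_le_card_mul_sum_sq (s := B) (f := fun x => g x ^ 2)
      simp only [← pow_mul] at h2
      norm_num at h2
      calc (∑ x ∈ B, g x) ^ 4 = ((∑ x ∈ B, g x) ^ 2) ^ 2 := by ring
        _ ≤ (B.card * ∑ x ∈ B, g x ^ 2) ^ 2 := by gcongr
        _ = B.card ^ 2 * (∑ x ∈ B, g x ^ 2) ^ 2 := by ring
        _ ≤ B.card ^ 2 * (B.card * ∑ x ∈ B, g x ^ 4) := by gcongr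
        _ = _ := by ring
    calc _ ≤ (B.card : ℝ) ^ 3 * ∑ x ∈ B, (1 - f (x + u)) ^ 4 := hh
      _ = (B.card : ℝ) ^ 3 * ∑ x ∈ B, (f x - f (x + u)) ^ 4 := by
          congr 1
          exact Finset.sum_congr rfl fun x hx => by rw [hfB x hx]
      _ ≤ (B.card : ℝ) ^ 3 * ∑ x, (f x - f (x + u)) ^ 4 := by
          gcongr
          exact Finset.subset_univ _
      _ ≤ (B.card : ℝ) ^ 3 * (256 * (6 * (K * B.card) / k ^ 2)) := by
          gcongr
          refine hu.trans ?_
          simp only [δ]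
          gcongr
      _ = (B.card : ℝ) ^ 4 / 16 * ((24576 * K) / k ^ 2) := by ring
      _ ≤ (B.card : ℝ) ^ 4 / 16 * 1 := by
          gcongr
          exact div_le_one_of_le₀ hkK (by positivity)
      _ = _ := by ring
  have hle := le_of_pow_le_pow_left₀ (by norm_num) (by positivity) hsum4
  rw [Finset.sum_sub_distrib] at hle
  simp only [Finset.sum_const, nsmul_eq_mul, mul_one] at hle
  have hf : ∑ b ∈ B, ∑ b' ∈ B, (if b + b' + u ∈ S then (1 : ℝ) else 0)
      = B.card * ∑ x ∈ B, f (x + u) := by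
    simp only [f, translateDensity]
    rw [← Finset.sum_div, mul_div_cancel₀ _ hB'.ne']
    refine Finset.sum_congr rfl fun b _ => ?_
    rw [Finset.sum_coe_sort B fun b' => if b + u + b' ∈ S then (1 : ℝ) else 0]
    simp only [add_right_comm]
  rw [hf]
  nlinarith

end AlmostPeriods

/-! ### Chang's theorem and a Bohr set in `4B - 4B`. -/

section Spectrum

open Finset
open scoped BigOperators

variable {G : Type*} [AddCommGroup G] [Fintype G]

/-- **Chang's theorem**, for dissociated subsets of the large spectrum. -/
theorem card_le_of_addDissociated_spectrum {T : Finset G} (hT : T.Nonempty) {η : ℝ} (hη : 0 < η)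
    {Λ : Finset (AddChar G ℂ)} (hΛ : AddDissociated (Λ : Set (AddChar G ℂ)))
    (hspec : ∀ ψ ∈ Λ, η * T.card ≤ ‖∑ t ∈ T, ψ t‖) :
    η ^ 2 * Λ.card ≤ 2 * Real.log (Fintype.card G / T.card) := by
  classical
  have hT' : (0 : ℝ) < T.card := by exact_mod_cast hT.card_pos
  have hG : (0 : ℝ) < Fintype.card G := by exact_mod_cast Fintype.card_pos
  choose ω hω hωT using fun ψ : AddChar G ℂ => RCLike.exists_norm_eq_mul_self (∑ t ∈ T, ψ t)
  let y : AddChar G ℂ → G → ℝ := fun ψ a => (ω ψ * ψ a).re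
  have hy : ∀ ψ a, |y ψ a| ≤ 1 := fun ψ a => by
    refine (Complex.abs_re_le_norm _).trans ?_
    rw [norm_mul, hω, ψ.norm_apply, one_mul]
  have hysum : ∀ ψ, ∑ t ∈ T, y ψ t = ‖∑ t ∈ T, ψ t‖ := fun ψ => by
    simp only [y]
    rw [← Complex.re_sum, ← mul_sum, ← hωT]
    simp
  -- Riesz product: by dissociativity only the product of the constant terms survives averaging over
  -- `G`.
  have hrand := AddDissociated.randomisation (fun ψ => if ψ ∈ Λ then Real.cosh η else 1)
    (fun ψ => if ψ ∈ Λ then (Real.sinh η : ℂ) * ω ψ else 0)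
    (hΛ.subset fun ψ hψ => by
      by_contra hcon
      exact hψ (if_neg hcon))
  have hprod : ∀ a, ∏ ψ, ((if ψ ∈ Λ then Real.cosh η else 1)
      + ((if ψ ∈ Λ then (Real.sinh η : ℂ) * ω ψ else 0) * ψ a).re)
      = ∏ ψ ∈ Λ, (Real.cosh η + y ψ a * Real.sinh η) := by
    intro a
    rw [← prod_filter_mul_prod_filter_not univ (· ∈ Λ)]
    rw [prod_congr rfl fun ψ (hψ : ψ ∈ univ.filter (· ∈ Λ)) =>
        (show _ = Real.cosh η + y ψ a * Real.sinh η from ?_),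
      prod_congr rfl fun ψ (hψ : ψ ∈ univ.filter (¬ · ∈ Λ)) => (show _ = (1 : ℝ) from ?_)]
    · simp
    · simp [(mem_filter.1 hψ).2]
    · rw [if_pos (mem_filter.1 hψ).2, if_pos (mem_filter.1 hψ).2, mul_assoc,
        Complex.re_ofReal_mul, mul_comm]
  have hcosh : ∏ ψ : AddChar G ℂ, (if ψ ∈ Λ then Real.cosh η else 1) = Real.cosh η ^ Λ.card := by
    rw [prod_ite_mem]
    simp
  simp only [hprod, hcosh] at hrand
  -- On `[-1, 1]` the convex function `exp (η y)` lies below its chord.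
  have hexp : ∀ a, Real.exp (η * ∑ ψ ∈ Λ, y ψ a) ≤ ∏ ψ ∈ Λ, (Real.cosh η + y ψ a * Real.sinh η) := by
    intro a
    rw [mul_sum, Real.exp_sum]
    exact prod_le_prod (fun _ _ => (Real.exp_pos _).le) fun ψ _ =>
      mul_comm η (y ψ a) ▸ Real.exp_mul_le_cosh_add_mul_sinh (hy ψ a) η
  have hE : ∑ a, Real.exp (η * ∑ ψ ∈ Λ, y ψ a) ≤ Fintype.card G * Real.exp (η ^ 2 / 2 * Λ.card) := by
    rw [Fintype.expect_eq_sum_div_card, div_eq_iff hG.ne'] at hrand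
    calc _ ≤ _ := sum_le_sum fun a _ => hexp a
      _ = Real.cosh η ^ Λ.card * Fintype.card G := hrand
      _ ≤ Real.exp (η ^ 2 / 2) ^ Λ.card * Fintype.card G := by
          gcongr
          exact Real.cosh_le_exp_half_sq η
      _ = _ := by rw [← Real.exp_nat_mul]; ring_nf
  -- On `T` each `y ψ` has mean at least `η`, so Jensen gives exponent `η² |Λ|`, against `η² |Λ| /
  -- 2` on all of `G`.
  have hjensen : Real.exp (η ^ 2 * Λ.card) * T.card ≤ ∑ t ∈ T, Real.exp (η * ∑ ψ ∈ Λ, y ψ t) := by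
    have h := convexOn_exp.map_sum_le (t := T) (w := fun _ => (T.card : ℝ)⁻¹)
      (p := fun t => η * ∑ ψ ∈ Λ, y ψ t) (fun _ _ => by positivity)
      (by simp [hT'.ne']) (fun _ _ => Set.mem_univ _)
    simp only [smul_eq_mul, ← mul_sum] at h
    rw [inv_mul_eq_div, inv_mul_eq_div, le_div_iff₀ hT'] at h
    refine le_trans ?_ h
    gcongr
    rw [le_div_iff₀ hT', sum_comm]
    calc η ^ 2 * Λ.card * T.card = η * ∑ ψ ∈ Λ, η * T.card := by simp; ring
      _ ≤ η * ∑ ψ ∈ Λ, ∑ t ∈ T, y ψ t := by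
          gcongr with ψ hψ
          rw [hysum]
          exact hspec ψ hψ
  have hfin : Real.exp (η ^ 2 / 2 * Λ.card) ≤ Fintype.card G / T.card := by
    rw [le_div_iff₀ hT']
    refine le_of_mul_le_mul_left ?_ (Real.exp_pos (η ^ 2 / 2 * Λ.card))
    calc Real.exp (η ^ 2 / 2 * Λ.card) * (Real.exp (η ^ 2 / 2 * Λ.card) * T.card)
        = Real.exp (η ^ 2 * Λ.card) * T.card := by
          rw [← mul_assoc, ← Real.exp_add]
          ring_nf
      _ ≤ _ := hjensen
      _ ≤ _ := sum_le_sum_of_subset_of_nonneg (subset_univ _) fun _ _ _ => (Real.exp_pos _).le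
      _ ≤ _ := hE
      _ = _ := mul_comm _ _
  have := (Real.le_log_iff_exp_le (by positivity)).2 hfin
  linarith

theorem norm_one_sub_prod_le {ι : Type*} (s : Finset ι) (z : ι → ℂ) (hz : ∀ i ∈ s, ‖z i‖ = 1) :
    ‖1 - ∏ i ∈ s, z i‖ ≤ ∑ i ∈ s, ‖1 - z i‖ := by
  classical
  induction s using Finset.induction_on with
  | empty => simp
  | insert a s ha ih =>
    rw [prod_insert ha, sum_insert ha]
    have h1 := ih fun i hi => hz i (mem_insert_of_mem hi)
    calc ‖1 - z a * ∏ i ∈ s, z i‖ = ‖(1 - z a) + z a * (1 - ∏ i ∈ s, z i)‖ := by ring_nf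
      _ ≤ ‖1 - z a‖ + ‖z a * (1 - ∏ i ∈ s, z i)‖ := norm_add_le _ _
      _ ≤ _ := by
        rw [norm_mul, hz a (mem_insert_self _ _), one_mul]
        gcongr

theorem norm_one_sub_apply_le_of_mem_addSpan [DecidableEq (AddChar G ℂ)] {Λ : Finset (AddChar G ℂ)}
    {ψ : AddChar G ℂ} (hψ : ψ ∈ Finset.addSpan Λ) (x : G) :
    ‖1 - ψ x‖ ≤ ∑ χ ∈ Λ, ‖1 - χ x‖ := by
  obtain ⟨ε, hε, rfl⟩ := Finset.mem_addSpan.1 hψ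
  rw [AddChar.sum_apply]
  refine (norm_one_sub_prod_le _ _ fun i _ => AddChar.norm_apply _ _).trans
    (sum_le_sum fun χ _ => ?_)
  rcases hε χ with h | h | h <;> rw [h]
  · rw [neg_smul, one_smul, AddChar.neg_apply, AddChar.map_neg_eq_conj]
    rw [← RCLike.norm_conj]
    simp
  · simp
  · simp

theorem sum_norm_sq_sum_addChar (X : Finset G) :
    ∑ ψ : AddChar G ℂ, ‖∑ a ∈ X, ψ a‖ ^ 2 = Fintype.card G * X.card := by
  classical
  have h : ∀ ψ : AddChar G ℂ, ((‖∑ a ∈ X, ψ a‖ ^ 2 : ℝ) : ℂ) = ∑ a ∈ X, ∑ b ∈ X, ψ (a - b) := by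
    intro ψ
    push_cast
    rw [← Complex.mul_conj', map_sum, sum_mul_sum]
    refine sum_congr rfl fun a _ => sum_congr rfl fun b _ => ?_
    rw [sub_eq_add_neg, AddChar.map_add_eq_mul, AddChar.map_neg_eq_conj]
  have h2 : ((∑ ψ : AddChar G ℂ, ‖∑ a ∈ X, ψ a‖ ^ 2 : ℝ) : ℂ) = ((Fintype.card G * X.card : ℝ) : ℂ) := by
    rw [Complex.ofReal_sum, sum_congr rfl fun ψ _ => h ψ, sum_comm]
    rw [sum_congr rfl fun a (_ : a ∈ X) => sum_comm]
    simp only [AddChar.sum_apply_eq_ite, sub_eq_zero]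
    simp
    ring
  exact_mod_cast h2

theorem sum_norm_mul_norm_sum_addChar_le (X Y : Finset G) :
    ∑ ψ : AddChar G ℂ, ‖∑ a ∈ X, ψ a‖ * ‖∑ a ∈ Y, ψ a‖
      ≤ Fintype.card G * Real.sqrt (X.card * Y.card) := by
  refine (Real.sum_mul_le_sqrt_mul_sqrt _ _ _).trans (le_of_eq ?_)
  rw [sum_norm_sq_sum_addChar, sum_norm_sq_sum_addChar, ← Real.sqrt_mul (by positivity)]
  rw [show (Fintype.card G * X.card * (Fintype.card G * Y.card) : ℝ)
    = (Fintype.card G : ℝ) ^ 2 * (X.card * Y.card) by ring, Real.sqrt_mul (by positivity),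
    Real.sqrt_sq (by positivity)]

variable [DecidableEq G]

theorem card_mul_indicator_eq_sum_addChar (S : Finset G) (y : G) :
    (Fintype.card G : ℂ) * (if y ∈ S then 1 else 0)
      = ∑ ψ : AddChar G ℂ, ψ y * starRingEnd ℂ (∑ s ∈ S, ψ s) := by
  have h : ∀ ψ : AddChar G ℂ, ψ y * starRingEnd ℂ (∑ s ∈ S, ψ s) = ∑ s ∈ S, ψ (y - s) := by
    intro ψ
    rw [map_sum, mul_sum]
    refine sum_congr rfl fun s _ => ?_
    rw [sub_eq_add_neg, AddChar.map_add_eq_mul, AddChar.map_neg_eq_conj]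
  simp only [h]
  rw [sum_comm]
  simp only [AddChar.sum_apply_eq_ite, sub_eq_zero]
  simp

/-- Fourier inversion of a representation count. The averaging over `2T - 2T` supplies the fourth
power of the transform of `T`. -/
theorem card_mul_sum_indicator_eq {B S T : Finset G} (x : G) :
    (Fintype.card G : ℂ) * ∑ t₁ ∈ T, ∑ t₂ ∈ T, ∑ t₃ ∈ T, ∑ t₄ ∈ T, ∑ b ∈ B, ∑ b' ∈ B,
        (if b + b' + (t₁ + t₂ - t₃ - t₄) + x ∈ S then 1 else 0)
      = ∑ ψ : AddChar G ℂ, (∑ b ∈ B, ψ b) ^ 2 * (∑ t ∈ T, ψ t) ^ 2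
        * (starRingEnd ℂ (∑ t ∈ T, ψ t)) ^ 2 * starRingEnd ℂ (∑ s ∈ S, ψ s) * ψ x := by
  simp only [mul_sum, card_mul_indicator_eq_sum_addChar]
  have hψ : ∀ ψ : AddChar G ℂ, (∑ b ∈ B, ψ b) ^ 2 * (∑ t ∈ T, ψ t) ^ 2
        * (starRingEnd ℂ (∑ t ∈ T, ψ t)) ^ 2 * starRingEnd ℂ (∑ s ∈ S, ψ s) * ψ x
      = ∑ t₁ ∈ T, ∑ t₂ ∈ T, ∑ t₃ ∈ T, ∑ t₄ ∈ T, ∑ b ∈ B, ∑ b' ∈ B,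
        ψ (b + b' + (t₁ + t₂ - t₃ - t₄) + x) * starRingEnd ℂ (∑ s ∈ S, ψ s) := by
    intro ψ
    have e : ∀ t₁ t₂ t₃ t₄ b b', ψ (b + b' + (t₁ + t₂ - t₃ - t₄) + x) * starRingEnd ℂ (∑ s ∈ S, ψ s)
        = ψ t₁ * (ψ t₂ * (starRingEnd ℂ (ψ t₃) * (starRingEnd ℂ (ψ t₄) * (ψ b * (ψ b' *
          (ψ x * starRingEnd ℂ (∑ s ∈ S, ψ s))))))) := by
      intro t₁ t₂ t₃ t₄ b b'
      simp only [sub_eq_add_neg, AddChar.map_add_eq_mul, AddChar.map_neg_eq_conj]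
      ring
    simp only [e, ← mul_sum, ← sum_mul]
    rw [map_sum (starRingEnd ℂ) (fun t => ψ t) T]
    ring
  simp only [hψ]
  symm
  rw [sum_comm]
  refine sum_congr rfl fun t₁ _ => ?_
  rw [sum_comm]
  refine sum_congr rfl fun t₂ _ => ?_
  rw [sum_comm]
  refine sum_congr rfl fun t₃ _ => ?_
  rw [sum_comm]
  refine sum_congr rfl fun t₄ _ => ?_
  rw [sum_comm]
  refine sum_congr rfl fun b _ => ?_
  exact sum_comm

/-- Almost periodicity of `B + B` along `2T - 2T` puts every `x` at which the large spectrum of `T`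
is close to `1` into `B + B - B - B - 2T + 2T`. -/
theorem exists_add_mem_of_spectrum {B T : Finset G} (hB : B.Nonempty) (hT : T.Nonempty) {K : ℝ}
    (hK : ((B + B).card : ℝ) ≤ K * B.card)
    (hper : ∀ t₁ ∈ T, ∀ t₂ ∈ T, ∀ t₃ ∈ T, ∀ t₄ ∈ T,
        (B.card : ℝ) ^ 2 ≤ 2 * ∑ b ∈ B, ∑ b' ∈ B,
          if b + b' + (t₁ + t₂ - t₃ - t₄) ∈ B + B then (1 : ℝ) else 0)
    {ρ η : ℝ} (hρ : 0 < ρ) (hρK : 4 * ρ ^ 2 * K < 1) (hηρ : 2 * η ^ 4 ≤ ρ) {x : G}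
    (hx : ∀ ψ : AddChar G ℂ, η * T.card ≤ ‖∑ t ∈ T, ψ t‖ → ‖1 - ψ x‖ ≤ ρ) :
    ∃ t₁ ∈ T, ∃ t₂ ∈ T, ∃ t₃ ∈ T, ∃ t₄ ∈ T, ∃ b ∈ B, ∃ b' ∈ B,
      b + b' + (t₁ + t₂ - t₃ - t₄) + x ∈ B + B := by
  -- If there were no representation, the count at `x` would vanish. Subtracting it from the large
  -- count `M` at 0 puts a factor `1 - ψ x` into every Fourier term.
  by_contra! hcon
  have hB' : (0 : ℝ) < B.card := by exact_mod_cast hB.card_pos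
  have hT' : (0 : ℝ) < T.card := by exact_mod_cast hT.card_pos
  have hG : (0 : ℝ) < Fintype.card G := by exact_mod_cast Fintype.card_pos
  have h0 := card_mul_sum_indicator_eq (B := B) (S := B + B) (T := T) 0
  have h1 := card_mul_sum_indicator_eq (B := B) (S := B + B) (T := T) x
  have hzero : ∑ t₁ ∈ T, ∑ t₂ ∈ T, ∑ t₃ ∈ T, ∑ t₄ ∈ T, ∑ b ∈ B, ∑ b' ∈ B,
        (if b + b' + (t₁ + t₂ - t₃ - t₄) + x ∈ B + B then (1 : ℂ) else 0) = 0 :=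
    sum_eq_zero fun t₁ h₁ => sum_eq_zero fun t₂ h₂ => sum_eq_zero fun t₃ h₃ =>
      sum_eq_zero fun t₄ h₄ => sum_eq_zero fun b hb => sum_eq_zero fun b' hb' =>
        if_neg (hcon t₁ h₁ t₂ h₂ t₃ h₃ t₄ h₄ b hb b' hb')
  rw [hzero, mul_zero] at h1
  set M : ℝ := ∑ t₁ ∈ T, ∑ t₂ ∈ T, ∑ t₃ ∈ T, ∑ t₄ ∈ T, ∑ b ∈ B, ∑ b' ∈ B,
        (if b + b' + (t₁ + t₂ - t₃ - t₄) ∈ B + B then (1 : ℝ) else 0) with hM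
  have hMlow : (T.card : ℝ) ^ 4 * (B.card : ℝ) ^ 2 ≤ 2 * M := by
    simp only [hM, mul_sum (s := T)]
    calc (T.card : ℝ) ^ 4 * (B.card : ℝ) ^ 2
        = ∑ t₁ ∈ T, ∑ t₂ ∈ T, ∑ t₃ ∈ T, ∑ t₄ ∈ T, (B.card : ℝ) ^ 2 := by simp; ring
      _ ≤ _ := sum_le_sum fun t₁ h₁ => sum_le_sum fun t₂ h₂ => sum_le_sum fun t₃ h₃ =>
          sum_le_sum fun t₄ h₄ => hper t₁ h₁ t₂ h₂ t₃ h₃ t₄ h₄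
  have hMcast : (Fintype.card G : ℂ) * (M : ℂ) = ∑ ψ : AddChar G ℂ, (∑ b ∈ B, ψ b) ^ 2
      * (∑ t ∈ T, ψ t) ^ 2 * (starRingEnd ℂ (∑ t ∈ T, ψ t)) ^ 2
      * starRingEnd ℂ (∑ s ∈ B + B, ψ s) * (1 - ψ x) := by
    simp only [mul_sub, mul_one, sum_sub_distrib, ← h1, sub_zero]
    simp only [add_zero, AddChar.map_zero_eq_one, mul_one] at h0
    rw [← h0, hM]
    congr 1
    simp only [Complex.ofReal_sum, apply_ite Complex.ofReal, Complex.ofReal_one, Complex.ofReal_zero]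
  have hnorm : (Fintype.card G : ℝ) * M ≤ ρ * T.card ^ 4 * B.card *
      (Fintype.card G * Real.sqrt (B.card * (B + B).card)) := by
    calc (Fintype.card G : ℝ) * M ≤ ‖(Fintype.card G : ℂ) * (M : ℂ)‖ := by
          rw [← Complex.ofReal_natCast, ← Complex.ofReal_mul, Complex.norm_real]
          exact Real.le_norm_self _
      _ ≤ ∑ ψ : AddChar G ℂ, ‖(∑ b ∈ B, ψ b) ^ 2
          * (∑ t ∈ T, ψ t) ^ 2 * (starRingEnd ℂ (∑ t ∈ T, ψ t)) ^ 2
          * starRingEnd ℂ (∑ s ∈ B + B, ψ s) * (1 - ψ x)‖ := by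
          rw [hMcast]
          exact norm_sum_le _ _
      _ ≤ ∑ ψ : AddChar G ℂ, ρ * T.card ^ 4 * B.card *
          (‖∑ b ∈ B, ψ b‖ * ‖∑ s ∈ B + B, ψ s‖) := by
          refine sum_le_sum fun ψ _ => ?_
          simp only [norm_mul, norm_pow, RCLike.norm_conj]
          have hle : ∀ X : Finset G, ‖∑ a ∈ X, ψ a‖ ≤ X.card := fun X => by
            refine (norm_sum_le _ _).trans ?_
            simp
          -- On the large spectrum `1 - ψ x` is small; elsewhere it is at most 2 and `2 η⁴ ≤ ρ`.
          have hkey : ‖∑ t ∈ T, ψ t‖ ^ 4 * ‖1 - ψ x‖ ≤ ρ * T.card ^ 4 := by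
            rcases le_or_gt (η * T.card) ‖∑ t ∈ T, ψ t‖ with h | h
            · calc _ ≤ (T.card : ℝ) ^ 4 * ρ := by
                    gcongr
                    · exact hle T
                    · exact hx ψ h
                _ = _ := mul_comm _ _
            · have h2 : ‖1 - ψ x‖ ≤ 2 := by
                refine (norm_sub_le _ _).trans ?_
                rw [norm_one, ψ.norm_apply]
                norm_num
              calc _ ≤ (η * T.card) ^ 4 * 2 := by gcongr
                _ = (2 * η ^ 4) * T.card ^ 4 := by ring
                _ ≤ _ := by gcongr
          calc _ = (‖∑ t ∈ T, ψ t‖ ^ 4 * ‖1 - ψ x‖) * ‖∑ b ∈ B, ψ b‖ *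
                (‖∑ b ∈ B, ψ b‖ * ‖∑ s ∈ B + B, ψ s‖) := by ring
            _ ≤ _ := by
              gcongr
              exact hle B
      _ ≤ _ := by
          rw [← mul_sum]
          gcongr
          exact sum_norm_mul_norm_sum_addChar_le _ _
  have hK0 : 0 ≤ K := by
    by_contra! hneg
    have : K * B.card < 0 := mul_neg_of_neg_of_pos hneg hB'
    have h2 : (0 : ℝ) ≤ (B + B).card := Nat.cast_nonneg _
    linarith
  have hsqrt : Real.sqrt (B.card * (B + B).card) ≤ Real.sqrt K * B.card := by
    rw [← Real.sqrt_sq hB'.le, ← Real.sqrt_mul hK0, Real.sqrt_sq hB'.le]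
    apply Real.sqrt_le_sqrt
    nlinarith
  have hlt : ρ * Real.sqrt K < 1 / 2 := by
    refine lt_of_pow_lt_pow_left₀ 2 (by norm_num) ?_
    rw [mul_pow, Real.sq_sqrt hK0]
    linarith
  have h3 : (Fintype.card G : ℝ) * M ≤ Fintype.card G *
      ((ρ * Real.sqrt K) * (T.card ^ 4 * B.card ^ 2)) := by
    calc _ ≤ _ := hnorm
      _ ≤ ρ * T.card ^ 4 * B.card * (Fintype.card G * (Real.sqrt K * B.card)) := by gcongr
      _ = _ := by ring
  have h4 := le_of_mul_le_mul_left h3 hG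
  have h5 : (0 : ℝ) < T.card ^ 4 * B.card ^ 2 := by positivity
  nlinarith

/-- If `B + B` is almost periodic along `2T - 2T`, then `4B - 4B` contains a Bohr set of small
rank. -/
theorem exists_bohr_subset {B T : Finset G} (hTB : T ⊆ B) (hT : T.Nonempty) {K : ℝ}
    (hK : ((B + B).card : ℝ) ≤ K * B.card)
    (hper : ∀ t₁ ∈ T, ∀ t₂ ∈ T, ∀ t₃ ∈ T, ∀ t₄ ∈ T,
        (B.card : ℝ) ^ 2 ≤ 2 * ∑ b ∈ B, ∑ b' ∈ B,
          if b + b' + (t₁ + t₂ - t₃ - t₄) ∈ B + B then (1 : ℝ) else 0)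
    {ρ η : ℝ} (hρ : 0 < ρ) (hη : 0 < η) (hρK : 4 * ρ ^ 2 * K < 1) (hηρ : 2 * η ^ 4 ≤ ρ) :
    ∃ Λ : Finset (AddChar G ℂ), η ^ 2 * Λ.card ≤ 2 * Real.log (Fintype.card G / T.card) ∧
      ∀ x, (∀ ψ ∈ Λ, Λ.card * ‖1 - ψ x‖ ≤ ρ) → x ∈ 4 • B - 4 • B := by
  classical
  have hT' : (0 : ℝ) < T.card := by exact_mod_cast hT.card_pos
  set R : ℝ := 2 * Real.log (Fintype.card G / T.card) / η ^ 2
  have hR : 0 ≤ R := by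
    refine div_nonneg (mul_nonneg zero_le_two (Real.log_nonneg ?_)) (by positivity)
    rw [one_le_div hT']
    exact_mod_cast Finset.card_le_univ T
  -- Chang's theorem bounds all dissociated subsets of the large spectrum, so at most `R` characters
  -- span it with coefficients -1, 0, 1.
  obtain ⟨Λ, -, hΛ, hspan⟩ := Finset.exists_subset_addSpan_card_le_of_forall_addDissociated
    (s := ({ψ | η * T.card ≤ ‖∑ t ∈ T, ψ t‖} : Finset (AddChar G ℂ))) (d := ⌊R⌋₊) (by
      intro Λ hΛ hdis
      have := card_le_of_addDissociated_spectrum hT hη hdis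
        fun ψ hψ => (mem_filter.1 (hΛ hψ)).2
      refine Nat.le_floor ?_
      rw [le_div_iff₀ (by positivity)]
      linarith)
  refine ⟨Λ, ?_, fun x hx => ?_⟩
  · have h := (Nat.cast_le.2 hΛ).trans (Nat.floor_le hR)
    rw [le_div_iff₀ (by positivity)] at h
    linarith
  obtain ⟨t₁, h₁, t₂, h₂, t₃, h₃, t₄, h₄, b, hb, b', hb', hmem⟩ :=
    exists_add_mem_of_spectrum (hT.mono hTB) hT hK hper hρ hρK hηρ (x := x) (by
      intro ψ hψ
      have hψspan := hspan (mem_filter.2 ⟨mem_univ _, hψ⟩)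
      refine (norm_one_sub_apply_le_of_mem_addSpan hψspan x).trans ?_
      rcases Λ.eq_empty_or_nonempty with rfl | hΛne
      · simpa using hρ.le
      have hc : (0 : ℝ) < Λ.card := by exact_mod_cast hΛne.card_pos
      calc ∑ χ ∈ Λ, ‖1 - χ x‖ ≤ ∑ χ ∈ Λ, ρ / Λ.card := by
            refine sum_le_sum fun χ hχ => ?_
            rw [le_div_iff₀ hc, mul_comm]
            exact hx χ hχ
        _ = ρ := by
            simp
            field_simp)
  obtain ⟨c, hc, c', hc', hcc⟩ := mem_add.1 hmem
  have h4 : ∀ p ∈ B, ∀ q ∈ B, ∀ r ∈ B, ∀ s ∈ B, p + q + r + s ∈ 4 • B := by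
    intro p hp q hq r hr s hs
    rw [show 4 • B = B + B + B + B by simp only [succ_nsmul, zero_nsmul, zero_add]]
    exact add_mem_add (add_mem_add (add_mem_add hp hq) hr) hs
  rw [show x = (c + c' + t₃ + t₄) - (b + b' + t₁ + t₂) by
    rw [show c + c' + t₃ + t₄ = (c + c') + t₃ + t₄ from rfl, hcc]; abel]
  exact sub_mem_sub (h4 _ hc _ hc' _ (hTB h₃) _ (hTB h₄)) (h4 _ hb _ hb' _ (hTB h₁) _ (hTB h₂))

end Spectrum

/-! ### Minkowski's second theorem. -/

section Minkowski

open Module MeasureTheory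

/-- Vectors of a lattice chosen greedily, each as short as possible outside the span of the
previous ones. -/
theorem exists_greedy_lattice_vectors {E : Type*} [NormedAddCommGroup E] [NormedSpace ℝ E]
    [FiniteDimensional ℝ E] {ι : Type*} [Finite ι] (b : Basis ι ℝ E) (j : ℕ)
    (hj : j ≤ finrank ℝ E) :
    ∃ v : Fin j → E, (∀ i, v i ∈ Submodule.span ℤ (Set.range b)) ∧ LinearIndependent ℝ v ∧
      ∀ x ∈ Submodule.span ℤ (Set.range b), ∀ i,
        x ∉ Submodule.span ℝ (v '' {k | k < i}) → ‖v i‖ ≤ ‖x‖ := by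
  induction j with
  | zero => exact ⟨Fin.elim0, fun i => i.elim0, linearIndependent_empty_type, fun _ _ i => i.elim0⟩
  | succ j ih =>
    obtain ⟨v, hv, hli, hmin⟩ := ih (Nat.le_of_succ_le hj)
    set W := Submodule.span ℝ (Set.range v)
    obtain ⟨i₀, hi₀⟩ : ∃ i, b i ∉ W := by
      by_contra! hcon
      have htop : W = ⊤ := by
        rw [eq_top_iff, ← b.span_eq, Submodule.span_le]
        rintro _ ⟨i, rfl⟩
        exact hcon i
      have h1 : finrank ℝ W = j := by simpa using finrank_span_eq_card hli
      rw [htop, finrank_top] at h1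
      omega
    have hprop : ProperSpace E := FiniteDimensional.proper ℝ E
    -- Only finitely many lattice points are as short as `b i₀`, so a shortest one outside `W`
    -- exists.
    have hfin := ZSpan.setFinite_inter b (Metric.isBounded_closedBall (x := (0 : E)) (r := ‖b i₀‖))
    obtain ⟨w, ⟨⟨hwb, hwΛ⟩, hwW⟩, hwmin⟩ := Set.exists_min_image
      ((Metric.closedBall (0 : E) ‖b i₀‖ ∩ Submodule.span ℤ (Set.range b)) \ W) (fun x => ‖x‖)
      hfin.sdiff
      ⟨b i₀, ⟨by simp, Submodule.subset_span ⟨i₀, rfl⟩⟩, hi₀⟩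
    refine ⟨Fin.snoc v w, fun i => ?_, linearIndependent_finSnoc.2 ⟨hli, hwW⟩, fun x hx i => ?_⟩
    · refine Fin.lastCases ?_ (fun i => ?_) i
      · simpa using hwΛ
      · simpa using hv i
    · refine Fin.lastCases ?_ (fun i => ?_) i
      · have himage : (Fin.snoc v w : Fin (j + 1) → E) '' {k | k < Fin.last j} = Set.range v := by
          ext y
          constructor
          · rintro ⟨k, hk, rfl⟩
            obtain ⟨k, rfl⟩ := Fin.exists_castSucc_eq.2 (ne_of_lt hk)
            exact ⟨k, by simp⟩
          · rintro ⟨k, rfl⟩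
            exact ⟨k.castSucc, Fin.castSucc_lt_last k, by simp⟩
        rw [himage, Fin.snoc_last]
        intro hxW
        rcases le_or_gt ‖x‖ ‖b i₀‖ with h | h
        · exact hwmin x ⟨⟨by simpa using h, hx⟩, hxW⟩
        · exact (by simpa using hwb : ‖w‖ ≤ ‖b i₀‖).trans h.le
      · have himage : (Fin.snoc v w : Fin (j + 1) → E) '' {k | k < i.castSucc}
            = v '' {k | k < i} := by
          ext y
          constructor
          · rintro ⟨k, hk, rfl⟩
            obtain ⟨k, rfl⟩ := Fin.exists_castSucc_eq.2
              (ne_of_lt (lt_of_lt_of_le hk (Fin.le_last _)))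
            exact ⟨k, by simpa using hk, by simp⟩
          · rintro ⟨k, hk, rfl⟩
            exact ⟨k.castSucc, by simpa using hk, by simp⟩
        rw [himage, Fin.snoc_castSucc]
        exact hmin x hx i

theorem volume_setOf_abs_inner_lt {d : ℕ}
    (u : OrthonormalBasis (Fin d) ℝ (EuclideanSpace ℝ (Fin d))) (a : Fin d → ℝ) :
    volume {x | ∀ i, |inner ℝ (u i) x| < a i} = ∏ i, ENNReal.ofReal (2 * a i) := by
  have hset : {x | ∀ i, |inner ℝ (u i) x| < a i}
      = u.repr ⁻¹' (WithLp.ofLp ⁻¹' (Set.univ.pi fun i => Set.Ioo (-a i) (a i))) := by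
    ext x
    simp [abs_lt, OrthonormalBasis.repr_apply_apply]
  have hmeas : MeasurableSet (Set.univ.pi fun i : Fin d => Set.Ioo (-a i) (a i)) :=
    MeasurableSet.univ_pi fun i => measurableSet_Ioo
  rw [hset, u.measurePreserving_repr.measure_preimage
      ((PiLp.volume_preserving_ofLp (Fin d)).measurable hmeas).nullMeasurableSet,
    (PiLp.volume_preserving_ofLp (Fin d)).measure_preimage hmeas.nullMeasurableSet,
    Real.volume_pi_Ioo]
  refine Finset.prod_congr rfl fun i _ => ?_
  rw [sub_neg_eq_add, two_mul]

/-- A form of **Minkowski's second theorem** for the Euclidean norm. -/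
theorem exists_linearIndependent_prod_norm_le {d : ℕ} (hd : 0 < d)
    (b : Basis (Fin d) ℝ (EuclideanSpace ℝ (Fin d))) :
    ∃ v : Fin d → EuclideanSpace ℝ (Fin d), (∀ i, v i ∈ Submodule.span ℤ (Set.range b)) ∧
      LinearIndependent ℝ v ∧
      ∏ i, ‖v i‖ ≤ Real.sqrt d ^ d * (volume (ZSpan.fundamentalDomain b)).toReal := by
  obtain ⟨v, hv, hli, hmin⟩ := exists_greedy_lattice_vectors b d (by simp)
  refine ⟨v, hv, hli, ?_⟩
  have hd' : (0 : ℝ) < d := by exact_mod_cast hd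
  have hsd : 0 < Real.sqrt d := Real.sqrt_pos.2 hd'
  have hv0 : ∀ i, 0 < ‖v i‖ := fun i => norm_pos_iff.2 (hli.ne_zero i)
  let u := InnerProductSpace.gramSchmidtOrthonormalBasis (𝕜 := ℝ) (by simp) v
  have hu : ∀ i j, i < j → inner ℝ (u j) (v i) = 0 := fun i j hij =>
    InnerProductSpace.gramSchmidtOrthonormalBasis_inv_triangular _ v hij
  -- A nonzero lattice point `x` of this Gram–Schmidt box would first enter the span of the `v i` at
  -- some index `j`. Then its components beyond `j` vanish, so `‖x‖ < ‖v j‖` against the greedy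
  -- choice. Hence the convex body theorem bounds the volume of the box.
  let s : Set (EuclideanSpace ℝ (Fin d)) := {x | ∀ i, |inner ℝ (u i) x| < ‖v i‖ / Real.sqrt d}
  have hmono : ∀ i j, i ≤ j → ‖v i‖ ≤ ‖v j‖ := fun i j hij => by
    refine hmin _ (hv j) i ?_
    exact hli.notMem_span_image (not_lt.2 hij)
  have hle : volume s ≤ volume (ZSpan.fundamentalDomain b) * 2 ^ d := by
    by_contra! hlt
    have : Countable (Submodule.span ℤ (Set.range b)).toAddSubgroup :=
      inferInstanceAs (Countable (Submodule.span ℤ (Set.range b)))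
    obtain ⟨⟨x, hx⟩, hx0, hxs⟩ := exists_ne_zero_mem_lattice_of_measure_mul_two_pow_lt_measure
      (s := s) (ZSpan.isAddFundamentalDomain' b volume)
      (fun x hx i => by simpa [inner_neg_right] using hx i)
      (by
        have : s = ⋂ i, (fun x => inner ℝ (u i) x) ⁻¹' Set.Ioo (-(‖v i‖ / Real.sqrt d))
            (‖v i‖ / Real.sqrt d) := by
          ext x
          simp [s, abs_lt]
        rw [this]
        exact convex_iInter fun i =>
          (convex_Ioo _ _).is_linear_preimage (innerSL ℝ (u i)).toLinearMap.isLinear)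
      (by simpa using hlt)
    have hx0' : x ≠ 0 := fun h => hx0 (Subtype.ext h)
    have htop : Submodule.span ℝ (Set.range v) = ⊤ :=
      hli.span_eq_top_of_card_eq_finrank' (by simp)
    have hex : ∃ n : ℕ, x ∈ Submodule.span ℝ (v '' {k : Fin d | (k : ℕ) < n}) := by
      refine ⟨d, ?_⟩
      have : {k : Fin d | (k : ℕ) < d} = Set.univ := by ext k; simp
      rw [this, Set.image_univ, htop]
      trivial
    classical
    obtain ⟨n, hn, hnmin⟩ : ∃ n, x ∈ Submodule.span ℝ (v '' {k : Fin d | (k : ℕ) < n}) ∧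
        ∀ m < n, x ∉ Submodule.span ℝ (v '' {k : Fin d | (k : ℕ) < m}) :=
      ⟨Nat.find hex, Nat.find_spec hex, fun m hm => Nat.find_min hex hm⟩
    obtain rfl | ⟨j, rfl⟩ : n = 0 ∨ ∃ j, n = j + 1 := by
      cases n <;> simp
    · simp at hn
      exact hx0' hn
    have hjd : j < d := by
      by_contra! hdj
      refine hnmin j (Nat.lt_succ_self j) ?_
      have : {k : Fin d | (k : ℕ) < j} = Set.univ := by
        ext k
        simpa using k.2.trans_le hdj
      rw [this, Set.image_univ, htop]
      trivial
    have hxj : ‖v ⟨j, hjd⟩‖ ≤ ‖x‖ := hmin x hx ⟨j, hjd⟩ (hnmin j (Nat.lt_succ_self j))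
    have hinner : ∀ i : Fin d, ⟨j, hjd⟩ < i → inner ℝ (u i) x = 0 := by
      intro i hi
      have hsub : Submodule.span ℝ (v '' {k : Fin d | (k : ℕ) < j + 1})
          ≤ LinearMap.ker (innerSL ℝ (u i)).toLinearMap := by
        rw [Submodule.span_le]
        rintro _ ⟨k, hk, rfl⟩
        refine hu k i (lt_of_le_of_lt ?_ hi)
        exact Fin.le_def.2 (Nat.lt_succ_iff.1 hk)
      exact hsub hn
    have hsq := u.sum_sq_norm_inner_right x
    have hlt' : ∑ i, ‖inner ℝ (u i) x‖ ^ 2 < ∑ _i : Fin d, ‖v ⟨j, hjd⟩‖ ^ 2 / d := by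
      refine Finset.sum_lt_sum_of_nonempty ⟨⟨j, hjd⟩, Finset.mem_univ _⟩ fun i _ => ?_
      have hpos : 0 < ‖v ⟨j, hjd⟩‖ ^ 2 / d := by have := hv0 ⟨j, hjd⟩; positivity
      rcases lt_or_ge ⟨j, hjd⟩ i with h | h
      · rw [hinner i h]
        simpa using hpos
      · calc ‖inner ℝ (u i) x‖ ^ 2 < (‖v i‖ / Real.sqrt d) ^ 2 := by
              have := hxs i
              rw [Real.norm_eq_abs]
              gcongr
          _ ≤ (‖v ⟨j, hjd⟩‖ / Real.sqrt d) ^ 2 := by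
              gcongr
              exact hmono _ _ h
          _ = _ := by rw [div_pow, Real.sq_sqrt hd'.le]
    rw [hsq] at hlt'
    simp only [Finset.sum_const, Finset.card_univ, Fintype.card_fin, nsmul_eq_mul] at hlt'
    rw [mul_div_cancel₀ _ hd'.ne'] at hlt'
    exact absurd (lt_of_pow_lt_pow_left₀ 2 (norm_nonneg _) hlt') (not_lt.2 hxj)
  have hfin : volume (ZSpan.fundamentalDomain b) ≠ ⊤ :=
    (ZSpan.fundamentalDomain_isBounded b).measure_lt_top.ne
  rw [volume_setOf_abs_inner_lt] at hle
  have hreal := ENNReal.toReal_mono (ENNReal.mul_ne_top hfin (by simp)) hle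
  rw [ENNReal.toReal_prod, ENNReal.toReal_mul, ENNReal.toReal_pow] at hreal
  have hprod : ∏ i, (ENNReal.ofReal (2 * (‖v i‖ / Real.sqrt d))).toReal
      = 2 ^ d * (∏ i, ‖v i‖) / Real.sqrt d ^ d := by
    rw [Finset.prod_congr rfl fun i _ => ENNReal.toReal_ofReal (by positivity)]
    rw [Finset.prod_mul_distrib, Finset.prod_div_distrib]
    simp
    ring
  rw [hprod, div_le_iff₀ (by positivity)] at hreal
  refine le_of_mul_le_mul_left (hreal.trans (le_of_eq ?_)) (by positivity : (0 : ℝ) < 2 ^ d)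
  simp
  ring

end Minkowski

/-! ### Progressions inside Bohr sets of `ZMod N`. -/

section CyclicLattice

open Module MeasureTheory

/-- The integer vectors congruent modulo `N` to a multiple of `r` contain `n + 1` linearly
independent vectors whose lengths have a small product. -/
theorem exists_short_vectors {N n : ℕ} (hN : 0 < N) {r : Fin (n + 1) → ℤ} (hr : r 0 = 1) :
    ∃ z : Fin (n + 1) → Fin (n + 1) → ℤ, (∀ j i, (N : ℤ) ∣ z j i - r i * z j 0) ∧
      LinearIndependent ℝ (fun j => WithLp.toLp 2 fun i => (z j i : ℝ)) ∧
      ∏ j, ‖WithLp.toLp 2 fun i => (z j i : ℝ)‖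
        ≤ Real.sqrt (n + 1 : ℕ) ^ (n + 1) * (N : ℝ) ^ n := by
  classical
  -- Generators `r` and `N eⱼ` for `j ≥ 1`. As `r 0 = 1`, the matrix is triangular with determinant
  -- `N^n`.
  let c : Fin (n + 1) → Fin (n + 1) → ℤ := fun j => Fin.cases r (fun j => Pi.single j.succ (N : ℤ)) j
  let w : Fin (n + 1) → EuclideanSpace ℝ (Fin (n + 1)) := fun j => WithLp.toLp 2 fun i => (c j i : ℝ)
  let e := EuclideanSpace.basisFun (Fin (n + 1)) ℝ
  have hdet : e.toBasis.det w = (N : ℝ) ^ n := by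
    rw [Basis.det_apply, Matrix.det_of_isLowerTriangular]
    · rw [Fin.prod_univ_succ]
      simp [Basis.toMatrix_apply, w, c, e, hr]
    · intro i j hij
      have hij' : i < j := hij
      obtain ⟨j, rfl⟩ := Fin.exists_succ_eq.2 (ne_of_gt (lt_of_le_of_lt (Fin.zero_le i) hij'))
      simp [Basis.toMatrix_apply, w, c, e, hij'.ne]
  have hN' : (N : ℝ) ≠ 0 := by exact_mod_cast hN.ne'
  have hbasis := e.toBasis.is_basis_iff_det.2 (hdet ▸ (pow_ne_zero n hN').isUnit)
  let b : Basis (Fin (n + 1)) ℝ (EuclideanSpace ℝ (Fin (n + 1))) :=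
    Basis.mk hbasis.1 hbasis.2.ge
  have hb : ⇑b = w := Basis.coe_mk _ _
  have hmem : ∀ x ∈ Submodule.span ℤ (Set.range b), ∃ z : Fin (n + 1) → ℤ,
      (x = WithLp.toLp 2 fun i => (z i : ℝ)) ∧ ∀ i, (N : ℤ) ∣ z i - r i * z 0 := by
    intro x hx
    induction hx using Submodule.span_induction with
    | mem x hx =>
      obtain ⟨j, rfl⟩ := hx
      refine ⟨c j, by rw [hb], fun i => ?_⟩
      refine Fin.cases ?_ (fun j => ?_) j
      · simp [c, hr]
      · by_cases h : i = j.succ <;> simp [c, h]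
    | zero => exact ⟨0, by ext; simp, by simp⟩
    | add x y _ _ hx hy =>
      obtain ⟨z, rfl, hz⟩ := hx
      obtain ⟨z', rfl, hz'⟩ := hy
      refine ⟨z + z', by ext; simp, fun i => ?_⟩
      rw [show (z + z') i - r i * (z + z') 0 = (z i - r i * z 0) + (z' i - r i * z' 0) by
        simp only [Pi.add_apply]
        ring]
      exact dvd_add (hz i) (hz' i)
    | smul a x _ hx =>
      obtain ⟨z, rfl, hz⟩ := hx
      refine ⟨a • z, by ext; simp, fun i => ?_⟩
      rw [show (a • z) i - r i * (a • z) 0 = a * (z i - r i * z 0) by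
        simp only [Pi.smul_apply, smul_eq_mul]
        ring]
      exact (hz i).mul_left a
  obtain ⟨v, hv, hli, hprod⟩ := exists_linearIndependent_prod_norm_le (Nat.succ_pos n) b
  choose z hz hzN using fun j => hmem (v j) (hv j)
  have hvz : v = fun j => WithLp.toLp 2 fun i => (z j i : ℝ) := funext hz
  refine ⟨z, hzN, hvz ▸ hli, ?_⟩
  have hvol : (volume (ZSpan.fundamentalDomain b)).toReal = (N : ℝ) ^ n := by
    rw [ZSpan.measure_fundamentalDomain b volume e.toBasis, hb, hdet,
      measure_congr (ZSpan.fundamentalDomain_ae_parallelepiped e.toBasis volume),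
      OrthonormalBasis.coe_toBasis, e.volume_parallelepiped]
    simp
  rw [hvol] at hprod
  convert hprod using 2
  rw [hvz]

/-- A Bohr set of rank `n` in `ZMod N` contains a large proper progression of dimension `n + 1`. -/
theorem exists_progression_in_bohr {N n : ℕ} (hN : 0 < N) {r : Fin (n + 1) → ℤ} (hr : r 0 = 1)
    {ρ : ℝ} (hρ : 0 < ρ) (hρ2 : ρ < 1 / 2) :
    ∃ (x : Fin (n + 1) → ℤ) (L : Fin (n + 1) → ℕ),
      (∀ l : Fin (n + 1) → ℤ, (∀ i, |l i| ≤ L i) → ∀ k, ∃ v : ℤ,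
        (v : ZMod N) = r k * ((∑ i, l i * x i : ℤ) : ZMod N) ∧ |(v : ℝ)| ≤ ρ * N) ∧
      (∀ l l' : Fin (n + 1) → ℤ, (∀ i, |l i| ≤ L i) → (∀ i, |l' i| ≤ L i) →
        ((∑ i, l i * x i : ℤ) : ZMod N) = ((∑ i, l' i * x i : ℤ) : ZMod N) → l = l') ∧
      (ρ / ((n + 1 : ℕ) * Real.sqrt (n + 1 : ℕ))) ^ (n + 1) * N ≤ ∏ i, (2 * L i + 1 : ℝ) := by
  obtain ⟨z, hz, hli, hprod⟩ := exists_short_vectors hN hr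
  have hN' : (0 : ℝ) < N := by exact_mod_cast hN
  set d : ℝ := ((n + 1 : ℕ) : ℝ) with hd
  have hd0 : 0 < d := by positivity
  set lam : Fin (n + 1) → ℝ := fun j => ‖WithLp.toLp 2 fun i => (z j i : ℝ)‖
  have hlam : ∀ j, 0 < lam j := fun j => norm_pos_iff.2 (hli.ne_zero j)
  have hzlam : ∀ j i, |(z j i : ℝ)| ≤ lam j := fun j i => by
    have := PiLp.norm_apply_le (WithLp.toLp 2 fun i => (z j i : ℝ)) i
    simpa using this
  -- Each of the `d` vectors may use a share `ρ N / d` of the allowed coordinate size.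
  let L : Fin (n + 1) → ℕ := fun j => ⌊ρ * N / (d * lam j)⌋₊
  have hL : ∀ j, (L j : ℝ) * lam j ≤ ρ * N / d := fun j => by
    have h : (L j : ℝ) ≤ ρ * N / (d * lam j) :=
      Nat.floor_le (div_nonneg (by positivity) (mul_nonneg hd0.le (hlam j).le))
    calc (L j : ℝ) * lam j ≤ ρ * N / (d * lam j) * lam j := by
          have := (hlam j).le
          gcongr
      _ = _ := by
          have := (hlam j).ne'
          field_simp
  have hbound : ∀ l : Fin (n + 1) → ℤ, (∀ i, |l i| ≤ L i) → ∀ k,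
      |((∑ i, l i * z i k : ℤ) : ℝ)| ≤ ρ * N := by
    intro l hl k
    push_cast
    calc |∑ i, (l i : ℝ) * z i k| ≤ ∑ i, |(l i : ℝ) * z i k| := Finset.abs_sum_le_sum_abs _ _
      _ ≤ ∑ _i : Fin (n + 1), ρ * N / d := by
          refine Finset.sum_le_sum fun i _ => ?_
          rw [abs_mul]
          have h1 : |(l i : ℝ)| ≤ L i := by exact_mod_cast hl i
          calc |(l i : ℝ)| * |(z i k : ℝ)| ≤ L i * lam i := by
                gcongr
                exact hzlam i k
            _ ≤ _ := hL i
      _ = ρ * N := by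
          simp only [Finset.sum_const, Finset.card_univ, Fintype.card_fin, nsmul_eq_mul, ← hd]
          field_simp
  have hcong : ∀ (l : Fin (n + 1) → ℤ) (k : Fin (n + 1)),
      ((∑ i, l i * z i k : ℤ) : ZMod N) = r k * ((∑ i, l i * z i 0 : ℤ) : ZMod N) := by
    intro l k
    have h : ∀ i, ((z i k : ℤ) : ZMod N) = r k * (z i 0 : ZMod N) := fun i => by
      have := (ZMod.intCast_zmod_eq_zero_iff_dvd _ N).2 (hz i k)
      push_cast at this
      exact sub_eq_zero.1 this
    push_cast
    rw [Finset.mul_sum]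
    refine Finset.sum_congr rfl fun i _ => ?_
    rw [h]
    ring
  refine ⟨fun i => z i 0, L, fun l hl k => ⟨∑ i, l i * z i k, hcong l k, hbound l hl k⟩, ?_, ?_⟩
  · intro l l' hl hl' heq
    have hzero : ∀ k, ∑ i, (l i - l' i) * z i k = 0 := by
      intro k
      have h1 : ((∑ i, l i * z i k : ℤ) : ZMod N) = ((∑ i, l' i * z i k : ℤ) : ZMod N) :=
        (hcong l k).trans ((congrArg _ heq).trans (hcong l' k).symm)
      have h2 : (N : ℤ) ∣ ∑ i, (l i - l' i) * z i k := by
        rw [← ZMod.intCast_zmod_eq_zero_iff_dvd]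
        simp only [sub_mul, Finset.sum_sub_distrib]
        rw [Int.cast_sub, h1, sub_self]
      -- The difference is a multiple of `N` of size at most `2 ρ N < N`; this is where `ρ < 1/2`
      -- enters.
      refine Int.eq_zero_of_abs_lt_dvd h2 ?_
      have h3 : |((∑ i, (l i - l' i) * z i k : ℤ) : ℝ)| < N := by
        simp only [sub_mul, Finset.sum_sub_distrib]
        rw [Int.cast_sub]
        calc _ ≤ _ := abs_sub _ _
          _ ≤ ρ * N + ρ * N := add_le_add (hbound l hl k) (hbound l' hl' k)
          _ < N := by nlinarith
      exact_mod_cast h3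
    have hlin := Fintype.linearIndependent_iff.1 hli (fun i => ((l i - l' i : ℤ) : ℝ)) (by
      ext k
      have := hzero k
      simp only [WithLp.ofLp_sum, Finset.sum_apply, PiLp.smul_apply, smul_eq_mul, PiLp.zero_apply]
      exact_mod_cast this)
    funext i
    have := hlin i
    rw [← sub_eq_zero]
    exact_mod_cast this
  · calc (ρ / (d * Real.sqrt d)) ^ (n + 1) * N
        = (ρ * N / d) ^ (n + 1) / (Real.sqrt d ^ (n + 1) * (N : ℝ) ^ n) := by
          have : 0 < Real.sqrt d := Real.sqrt_pos.2 hd0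
          rw [div_pow, div_pow, mul_pow, mul_pow]
          field_simp
          ring
      _ ≤ (ρ * N / d) ^ (n + 1) / ∏ j, lam j := by
          have : 0 < ∏ j, lam j := Finset.prod_pos fun j _ => hlam j
          gcongr
      _ = ∏ j, (ρ * N / (d * lam j)) := by
          simp only [div_mul_eq_div_div (ρ * N) d]
          rw [Finset.prod_div_distrib]
          simp [div_pow]
      _ ≤ ∏ j, (2 * L j + 1 : ℝ) := by
          refine Finset.prod_le_prod (fun j _ => ?_) fun j _ => ?_
          · exact div_nonneg (by positivity) (mul_nonneg hd0.le (hlam j).le)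
          · have h := (Nat.lt_floor_add_one (ρ * N / (d * lam j))).le
            have h0 : (0 : ℝ) ≤ L j := Nat.cast_nonneg _
            calc ρ * N / (d * lam j) ≤ (L j : ℝ) + 1 := h
              _ ≤ _ := by linarith

/-- A Bohr set in `ZMod N`, given by a finite set of characters, contains a large proper
progression. -/
theorem exists_progression_of_addChars {N : ℕ} [NeZero N] (Λ : Finset (AddChar (ZMod N) ℂ))
    {ρ : ℝ} (hρ : 0 < ρ) (hρ2 : ρ < 1 / 2) :
    ∃ (x : Fin (Λ.card + 1) → ℤ) (L : Fin (Λ.card + 1) → ℕ),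
      (∀ l : Fin (Λ.card + 1) → ℤ, (∀ i, |l i| ≤ L i) → ∀ ψ ∈ Λ,
        ‖1 - ψ ((∑ i, l i * x i : ℤ) : ZMod N)‖ ≤ 2 * Real.pi * ρ) ∧
      (∀ l l' : Fin (Λ.card + 1) → ℤ, (∀ i, |l i| ≤ L i) → (∀ i, |l' i| ≤ L i) →
        ((∑ i, l i * x i : ℤ) : ZMod N) = ((∑ i, l' i * x i : ℤ) : ZMod N) → l = l') ∧
      (ρ / ((Λ.card + 1 : ℕ) * Real.sqrt (Λ.card + 1 : ℕ))) ^ (Λ.card + 1) * N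
        ≤ ∏ i, (2 * L i + 1 : ℝ) := by
  have hN : 0 < N := NeZero.pos N
  have hN' : (0 : ℝ) < N := by exact_mod_cast hN
  let ξ : AddChar (ZMod N) ℂ → ZMod N := AddChar.zmodAddEquiv.symm
  -- The extra frequency 1 supplies the normalisation `r 0 = 1` and accounts for the extra
  -- dimension.
  obtain ⟨x, L, h1, h2, h3⟩ := exists_progression_in_bohr hN
    (r := Fin.cons 1 fun k => ((ξ (Λ.equivFin.symm k)).val : ℤ)) rfl hρ hρ2
  refine ⟨x, L, fun l hl ψ hψ => ?_, h2, h3⟩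
  obtain ⟨v, hv, hvρ⟩ := h1 l hl (Fin.succ (Λ.equivFin ⟨ψ, hψ⟩))
  have hξ : (((ξ ψ).val : ℤ) : ZMod N) = ξ ψ := by rw [Int.cast_natCast, ZMod.natCast_zmod_val]
  simp only [Fin.cons_succ, Equiv.symm_apply_apply, hξ] at hv
  have hψv : ψ ((∑ i, l i * x i : ℤ) : ZMod N) = ZMod.stdAddChar (v : ZMod N) := by
    rw [hv]
    conv_lhs => rw [← AddChar.zmodAddEquiv.apply_symm_apply ψ]
    rfl
  rw [hψv, ZMod.stdAddChar_coe, norm_sub_rev]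
  have hexp : (2 * Real.pi * Complex.I * v / N : ℂ)
      = Complex.I * ((2 * Real.pi * (v / N) : ℝ) : ℂ) := by
    push_cast
    ring
  rw [hexp]
  refine Real.norm_exp_I_mul_ofReal_sub_one_le.trans ?_
  rw [Real.norm_eq_abs, abs_mul, abs_of_pos Real.two_pi_pos, abs_div, abs_of_pos hN']
  gcongr
  rwa [div_le_iff₀ hN']

end CyclicLattice

theorem Finset.nsmul_sub_nsmul_mono {G : Type*} [AddCommGroup G] [DecidableEq G] {X : Finset G}
    (hX : X.Nonempty) {k m : ℕ} (hkm : k ≤ m) : k • X - k • X ⊆ m • X - m • X := by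
  obtain ⟨j, rfl⟩ := Nat.exists_eq_add_of_le hkm
  intro z hz
  obtain ⟨x, hx, y, hy, rfl⟩ := Finset.mem_sub.1 hz
  obtain ⟨c, hc⟩ := hX.nsmul (n := j)
  refine Finset.mem_sub.2 ⟨x + c, ?_, y + c, ?_, by abel⟩ <;> rw [add_nsmul]
  · exact Finset.add_mem_add hx hc
  · exact Finset.add_mem_add hy hc

/-! ### Ruzsa's modelling lemma. -/

section Modelling

/-- Least absolute residues lie between `-(p-1)/2` and `(p-1)/2`; multiples of `N` are counted
separately on each side of 0. -/
theorem card_filter_dvd_valMinAbs_mul_le {p N : ℕ} [NeZero p] (hp : Odd p) :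
    (Finset.univ.filter fun y : ZMod p => y ≠ 0 ∧ (N : ℤ) ∣ y.valMinAbs).card * N ≤ p - 1 := by
  classical
  set F := (Finset.Ioc 0 (p / 2)).filter fun m => N ∣ m
  have hF : F.card = p / 2 / N := Nat.Ioc_filter_dvd_card_eq_div _ _
  have hle : (Finset.univ.filter fun y : ZMod p => y ≠ 0 ∧ (N : ℤ) ∣ y.valMinAbs).card
      ≤ (F.image (fun m : ℕ => (m : ℤ)) ∪ F.image (fun m : ℕ => -(m : ℤ))).card := by
    refine Finset.card_le_card_of_injOn ZMod.valMinAbs ?_ fun x _ y _ h => ZMod.injective_valMinAbs h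
    intro y hy
    obtain ⟨hy0, hyN⟩ := (Finset.mem_filter.1 hy).2
    have hmem : y.valMinAbs.natAbs ∈ F := by
      refine Finset.mem_filter.2 ⟨Finset.mem_Ioc.2 ⟨?_, ZMod.natAbs_valMinAbs_le y⟩, ?_⟩
      · rw [Int.natAbs_pos]
        simpa using hy0
      · exact Int.natCast_dvd.1 hyN
    simp only [Finset.coe_union, Finset.coe_image, Set.mem_union, Set.mem_image, Finset.mem_coe]
    rcases Int.natAbs_eq y.valMinAbs with h | h
    · exact .inl ⟨_, hmem, h.symm⟩
    · exact .inr ⟨_, hmem, h.symm⟩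
  have hle2 := (hle.trans (Finset.card_union_le _ _)).trans
    (add_le_add Finset.card_image_le Finset.card_image_le)
  rw [hF] at hle2
  obtain ⟨m, rfl⟩ := hp
  have h1 : (2 * m + 1) / 2 = m := by omega
  rw [h1] at hle2
  have h2 := Nat.div_mul_le_self m N
  calc _ ≤ (m / N + m / N) * N := Nat.mul_le_mul_right _ hle2
    _ = 2 * (m / N * N) := by ring
    _ ≤ _ := by omega

/-- A multiplier modulo `p` for which no nonzero element of `D` has its dilate near `0` modulo `p`
divisible by `N`. -/
theorem exists_good_multiplier {D : Finset ℤ} (hD0 : 0 ∈ D) {N p : ℕ} [Fact p.Prime] (hp : Odd p)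
    (hDp : ∀ s ∈ D, s ≠ 0 → (s : ZMod p) ≠ 0) (hDN : D.card ≤ N) :
    ∃ q : ZMod p, ∀ s ∈ D, s ≠ 0 → ¬ (N : ℤ) ∣ (q * s).valMinAbs := by
  classical
  by_contra! hcon
  set Y := Finset.univ.filter fun y : ZMod p => y ≠ 0 ∧ (N : ℤ) ∣ y.valMinAbs
  have hY : Y.card * N ≤ p - 1 := card_filter_dvd_valMinAbs_mul_le hp
  -- Union bound: each of the `|D| - 1` nonzero `s` spoils at most `(p-1)/N` of the `p - 1` nonzero
  -- multipliers.
  have hsub : (Finset.univ.erase (0 : ZMod p)) ⊆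
      (D.erase 0).biUnion fun s => Y.image fun y => y * (s : ZMod p)⁻¹ := by
    intro q hq
    obtain ⟨s, hs, hs0, hsN⟩ := hcon q
    have hsp := hDp s hs hs0
    refine Finset.mem_biUnion.2 ⟨s, Finset.mem_erase.2 ⟨hs0, hs⟩, Finset.mem_image.2
      ⟨q * s, Finset.mem_filter.2 ⟨Finset.mem_univ _, mul_ne_zero (Finset.ne_of_mem_erase hq) hsp,
        hsN⟩, by field_simp⟩⟩
  have hcard := (Finset.card_le_card hsub).trans
    (Finset.card_biUnion_le_card_mul _ _ Y.card fun s _ => Finset.card_image_le)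
  rw [Finset.card_erase_of_mem (Finset.mem_univ _), Finset.card_univ, ZMod.card,
    Finset.card_erase_of_mem hD0] at hcard
  have hp1 : 0 < p - 1 := Nat.sub_pos_of_lt (Fact.out (p := p.Prime)).one_lt
  have hD1 : 0 < D.card := Finset.card_pos.2 ⟨0, hD0⟩
  have h1 : (p - 1) * N ≤ (D.card - 1) * (p - 1) := by
    calc (p - 1) * N ≤ (D.card - 1) * Y.card * N := Nat.mul_le_mul_right _ hcard
      _ = (D.card - 1) * (Y.card * N) := by ring
      _ ≤ _ := Nat.mul_le_mul_left _ hY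
  have h2 : N ≤ D.card - 1 := by
    rw [mul_comm] at h1
    exact Nat.le_of_mul_le_mul_right h1 hp1
  omega

/-- **Ruzsa's modelling lemma**: a large part of `A` is Freiman isomorphic of order `k` to a subset
of `ZMod N`; the isomorphism is presented by its graph. -/
theorem exists_freiman_model {A : Finset ℤ} (hA : A.Nonempty) {k : ℕ} (hk : 0 < k) {N : ℕ}
    (hN : (k • A - k • A).card ≤ N) :
    ∃ Γ : Finset (ℤ × ZMod N), (∀ z ∈ Γ, z.1 ∈ A) ∧ A.card ≤ 2 * k * Γ.card ∧
      ∀ z ∈ k • Γ - k • Γ, z.1 = 0 ↔ z.2 = 0 := by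
  classical
  set D := k • A - k • A
  have hD0 : (0 : ℤ) ∈ D := by
    obtain ⟨x, hx⟩ := hA.nsmul (n := k)
    exact Finset.mem_sub.2 ⟨x, hx, x, hx, sub_self x⟩
  obtain ⟨p, hpge, hp⟩ := Nat.exists_infinite_primes (∑ s ∈ D, s.natAbs + 3)
  have hodd : Odd p := hp.odd_of_ne_two (by omega)
  have : Fact p.Prime := ⟨hp⟩
  have hDp : ∀ s ∈ D, s ≠ 0 → (s : ZMod p) ≠ 0 := by
    intro s hs hs0 hsp
    rw [ZMod.intCast_zmod_eq_zero_iff_dvd] at hsp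
    have h1 : s.natAbs ≤ ∑ s ∈ D, s.natAbs :=
      Finset.single_le_sum (f := Int.natAbs) (fun _ _ => Nat.zero_le _) hs
    have h2 := Nat.le_of_dvd (Int.natAbs_pos.2 hs0) (Int.natCast_dvd.1 hsp)
    omega
  obtain ⟨q, hq⟩ := exists_good_multiplier hD0 hodd hDp hN
  let h : ℤ → ℕ := fun a => (q * (a : ZMod p)).val
  have hp0 : 0 < p := hp.pos
  have hh : ∀ a, h a < p := fun a => ZMod.val_lt _
  -- Restrict to a popular interval of length `p/(2k)`. Differences of `k`-fold sums of residues
  -- from it are then within `p/2` of 0, so nothing wraps around modulo `p`.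
  obtain ⟨j, -, hj⟩ := Finset.exists_le_card_fiber_of_nsmul_le_card_of_maps_to
    (s := A) (t := Finset.range (2 * k)) (f := fun a => 2 * k * h a / p)
    (b := (A.card : ℚ) / (2 * k))
    (fun a _ => Finset.mem_range.2 ((Nat.div_lt_iff_lt_mul hp0).2
      (Nat.mul_lt_mul_of_pos_left (hh a) (by positivity))))
    ⟨0, Finset.mem_range.2 (by positivity)⟩
    (by
      rw [Finset.card_range, nsmul_eq_mul]
      push_cast
      rw [mul_div_cancel₀]
      positivity)
  set A' := A.filter fun a => 2 * k * h a / p = j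
  refine ⟨A'.image fun a => (a, (h a : ZMod N)), ?_, ?_, ?_⟩
  · intro z hz
    obtain ⟨a, ha, rfl⟩ := Finset.mem_image.1 hz
    exact (Finset.mem_filter.1 ha).1
  · rw [Finset.card_image_of_injective _ fun a b hab => (Prod.ext_iff.1 hab).1]
    rw [div_le_iff₀ (by positivity)] at hj
    have hj' : (A.card : ℚ) ≤ 2 * k * A'.card := by linarith
    exact_mod_cast hj'
  · set Γ := A'.image fun a => (a, (h a : ZMod N))
    -- The integer `y` lifts `z.2`. The `+ m` in the upper bound encodes strictness, one unit per
    -- summand, as `valMinAbs` needs a strict lower bound.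
    have hΓ : ∀ (m : ℕ), ∀ z ∈ m • Γ, z.1 ∈ m • A ∧ ∃ y : ℤ, z.2 = y ∧ (y : ZMod p) = q * z.1 ∧
        m * j * p ≤ 2 * k * y ∧ 2 * k * y + m ≤ m * (j + 1) * p := by
      intro m
      induction m with
      | zero =>
        intro z hz
        rw [zero_nsmul, Finset.mem_zero] at hz
        subst hz
        exact ⟨by simp, 0, by simp⟩
      | succ m ih =>
        intro z hz
        rw [succ_nsmul] at hz
        obtain ⟨x, hx, w, hw, rfl⟩ := Finset.mem_add.1 hz
        obtain ⟨hxA, y, hy2, hyp, hy3, hy4⟩ := ih x hx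
        obtain ⟨a, ha, rfl⟩ := Finset.mem_image.1 hw
        obtain ⟨haA, haj⟩ := Finset.mem_filter.1 ha
        have h1 : j * p ≤ 2 * k * h a := by
          rw [← haj]
          exact Nat.div_mul_le_self _ _
        have h2 : 2 * k * h a < (j + 1) * p := by
          rw [← Nat.div_lt_iff_lt_mul hp0, haj]
          exact Nat.lt_succ_self j
        have h1' : (j : ℤ) * p ≤ 2 * k * h a := by exact_mod_cast h1
        have h2' : 2 * k * (h a : ℤ) + 1 ≤ (j + 1) * p := by exact_mod_cast h2
        refine ⟨?_, y + h a, ?_, ?_, ?_, ?_⟩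
        · rw [succ_nsmul]
          exact Finset.add_mem_add hxA haA
        · simp [hy2]
        · simp [hyp, h, mul_add]
        · push_cast
          linarith
        · push_cast
          linarith
    intro z hz
    obtain ⟨x, hx, w, hw, rfl⟩ := Finset.mem_sub.1 hz
    obtain ⟨hxA, y, hy2, hyp, hy3, hy4⟩ := hΓ k x hx
    obtain ⟨hwA, u, hu2, hup, hu3, hu4⟩ := hΓ k w hw
    have hk' : (0 : ℤ) < k := by exact_mod_cast hk
    have hup1 : (y - u) * 2 ≤ p := by
      have : (k : ℤ) * ((y - u) * 2) ≤ k * p := by linarith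
      exact le_of_mul_le_mul_left this hk'
    have hlow : -(p : ℤ) < (y - u) * 2 := by
      have : (k : ℤ) * (-(p : ℤ)) < k * ((y - u) * 2) := by linarith
      exact lt_of_mul_lt_mul_left this hk'.le
    have hval : (q * ((x.1 - w.1 : ℤ) : ZMod p)).valMinAbs = y - u := by
      refine (ZMod.valMinAbs_spec _ _).2 ⟨?_, hlow, hup1⟩
      push_cast
      rw [hyp, hup]
      ring
    have hmem : x.1 - w.1 ∈ D := Finset.sub_mem_sub hxA hwA
    rw [Prod.fst_sub, Prod.snd_sub, hy2, hu2, ← Int.cast_sub, ZMod.intCast_zmod_eq_zero_iff_dvd]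
    constructor
    · intro h0
      rw [h0, Int.cast_zero, mul_zero, ZMod.valMinAbs_zero] at hval
      rw [← hval]
      exact dvd_zero _
    · intro hdvd
      by_contra hne
      exact hq _ hmem hne (hval ▸ hdvd)

end Modelling

/-! ### Lifting progressions through a Freiman isomorphism. -/

section Transport

theorem sum_smul_eq_sum_sub_single_smul {ι M : Type*} [Fintype ι] [DecidableEq ι] [AddCommGroup M]
    (l : ι → ℤ) (i : ι) (ε : ℤ) (y : ι → M) :
    ∑ k, l k • y k = ∑ k, (l - Pi.single i ε : ι → ℤ) k • y k + ε • y i := by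
  have : ∑ k, (Pi.single i ε : ι → ℤ) k • y k = ε • y i := by
    rw [Finset.sum_eq_single i] <;> simp +contextual
  simp only [Pi.sub_apply, sub_smul, Finset.sum_sub_distrib, this]
  abel

variable {G H : Type*} [AddCommGroup G] [AddCommGroup H] [DecidableEq G] [DecidableEq H]
  {Γ : Finset (G × H)}

theorem fst_eq_iff_snd_eq_of_freiman (hΓ : Γ.Nonempty) {k m : ℕ} (hmk : m ≤ k)
    (h : ∀ z ∈ k • Γ - k • Γ, z.1 = 0 ↔ z.2 = 0) {z z' : G × H} (hz : z ∈ m • Γ)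
    (hz' : z' ∈ m • Γ) : z.1 = z'.1 ↔ z.2 = z'.2 := by
  have := h _ (Finset.nsmul_sub_nsmul_mono hΓ hmk (Finset.sub_mem_sub hz hz'))
  rwa [Prod.fst_sub, Prod.snd_sub, sub_eq_zero, sub_eq_zero] at this

/-- A progression in the second projection of `4Γ - 4Γ` lifts to the first projection. -/
theorem exists_lift_progression (hΓ : Γ.Nonempty) (h : ∀ z ∈ 12 • Γ - 12 • Γ, z.1 = 0 ↔ z.2 = 0)
    {d : ℕ} {x : Fin d → H} {L : Fin d → ℕ}
    (hx : ∀ l : Fin d → ℤ, (∀ i, |l i| ≤ L i) →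
      ∑ i, l i • x i ∈ 4 • Γ.image Prod.snd - 4 • Γ.image Prod.snd) :
    ∃ x' : Fin d → G, ∀ l : Fin d → ℤ, (∀ i, |l i| ≤ L i) →
      ∃ z ∈ 4 • Γ - 4 • Γ, z.2 = ∑ i, l i • x i ∧ z.1 = ∑ i, l i • x' i := by
  classical
  set B := Γ.image Prod.snd
  have hB : 4 • B - 4 • B = (4 • Γ - 4 • Γ).image (AddMonoidHom.snd G H) := by
    rw [show (4 • Γ - 4 • Γ).image (AddMonoidHom.snd G H) = _ from
      Finset.image_image₂_distrib (map_sub (AddMonoidHom.snd G H)), Finset.image_nsmul]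
    rfl
  have hlift : ∀ w : H, ∃ z : G × H, w ∈ 4 • B - 4 • B → z ∈ 4 • Γ - 4 • Γ ∧ z.2 = w := by
    intro w
    by_cases hw : w ∈ 4 • B - 4 • B
    · rw [hB] at hw
      obtain ⟨z, hz, rfl⟩ := Finset.mem_image.1 hw
      exact ⟨z, fun _ => ⟨hz, rfl⟩⟩
    · exact ⟨0, fun h => absurd h hw⟩
  choose γ hγ using hlift
  have hzero : ∀ w, w ∈ 4 • B - 4 • B → w = 0 → (γ w).1 = 0 := by
    intro w hw hw0
    obtain ⟨h1, h2⟩ := hγ w hw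
    exact (h _ (Finset.nsmul_sub_nsmul_mono hΓ (by norm_num) h1)).2 (h2.trans hw0)
  -- Three elements of `4Γ - 4Γ` are combined here, which is why the order is 12.
  have hadd : ∀ w w', w ∈ 4 • B - 4 • B → w' ∈ 4 • B - 4 • B → w + w' ∈ 4 • B - 4 • B →
      (γ (w + w')).1 = (γ w).1 + (γ w').1 := by
    intro w w' hw hw' hww
    obtain ⟨h1, h2⟩ := hγ _ hw
    obtain ⟨h1', h2'⟩ := hγ _ hw'
    obtain ⟨h1'', h2''⟩ := hγ _ hww
    have hmem : γ w + γ w' - γ (w + w') ∈ 12 • Γ - 12 • Γ := by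
      obtain ⟨a, ha, b, hb, hab⟩ := Finset.mem_sub.1 h1
      obtain ⟨a', ha', b', hb', hab'⟩ := Finset.mem_sub.1 h1'
      obtain ⟨a'', ha'', b'', hb'', hab''⟩ := Finset.mem_sub.1 h1''
      rw [← hab, ← hab', ← hab'', show a - b + (a' - b') - (a'' - b'')
        = (a + a' + b'') - (b + b' + a'') by abel,
        show 12 • Γ = 4 • Γ + 4 • Γ + 4 • Γ by rw [← add_nsmul, ← add_nsmul]]
      exact Finset.sub_mem_sub (Finset.add_mem_add (Finset.add_mem_add ha ha') hb'')
        (Finset.add_mem_add (Finset.add_mem_add hb hb') ha'')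
    have := (h _ hmem).2 (by simp [h2, h2', h2''])
    simp only [Prod.fst_sub, Prod.fst_add] at this
    exact (sub_eq_zero.1 this).symm
  refine ⟨fun i => (γ (x i)).1, fun l hl => ⟨γ (∑ i, l i • x i), (hγ _ (hx l hl)).1,
    (hγ _ (hx l hl)).2, ?_⟩⟩
  -- Move one coordinate a unit towards 0; this stays in the box, so local additivity suffices.
  induction hn : ∑ i, (l i).natAbs using Nat.strong_induction_on generalizing l with
  | _ n ih =>
    by_cases hl0 : ∀ i, l i = 0
    · rw [hzero _ (hx l hl) (by simp [hl0])]
      simp [hl0]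
    · push Not at hl0
      obtain ⟨i, hi⟩ := hl0
      obtain ⟨ε, hε, hεl⟩ : ∃ ε : ℤ, (ε = 1 ∨ ε = -1) ∧ (l i - ε).natAbs < (l i).natAbs := by
        rcases lt_or_gt_of_ne hi with h | h
        · exact ⟨-1, .inr rfl, by omega⟩
        · exact ⟨1, .inl rfl, by omega⟩
      set l' : Fin d → ℤ := l - Pi.single i ε with hl'def
      have hl' : ∀ k, |l' k| ≤ L k := by
        intro k
        have := hl k
        rw [Int.abs_eq_natAbs] at this ⊢
        by_cases hk : k = i
        · subst hk
          simp only [l', Pi.sub_apply, Pi.single_eq_same]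
          omega
        · simpa [l', hk] using this
      have hn' : ∑ k, (l' k).natAbs < n := by
        rw [← hn]
        refine Finset.sum_lt_sum (fun k _ => ?_) ⟨i, Finset.mem_univ _, ?_⟩
        · by_cases hk : k = i
          · subst hk
            simpa [l'] using hεl.le
          · simp [l', hk]
        · simpa [l'] using hεl
      have hsumx : ∑ k, l k • x k = ∑ k, l' k • x k + ε • x i :=
        sum_smul_eq_sum_sub_single_smul l i ε x
      have hone : ∀ σ : ℤ, |σ| = 1 → ∀ k, |(Pi.single i σ : Fin d → ℤ) k| ≤ L k := by
        intro σ hσ k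
        by_cases hk : k = i
        · subst hk
          have h1 := hl k
          have h2 : 1 ≤ |l k| := Int.one_le_abs hi
          simp only [Pi.single_eq_same, hσ]
          omega
        · simp [hk]
      have hxi : x i ∈ 4 • B - 4 • B := by
        have := hx _ (hone 1 (by simp))
        rwa [Finset.sum_eq_single i (by simp +contextual) (by simp), Pi.single_eq_same,
          one_smul] at this
      have ih' := ih _ hn' l' hl' rfl
      rw [sum_smul_eq_sum_sub_single_smul l i ε fun i => (γ (x i)).1, ← hl'def, ← ih']
      rcases hε with rfl | rfl
      · rw [one_smul] at hsumx
        rw [hsumx, one_smul, hadd _ _ (hx l' hl') hxi (hsumx ▸ hx l hl)]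
      -- For a negative coordinate, additivity is used from `l` to `l'`, so the lift of `-x i` is
      -- never needed.
      · have e : ∑ k, l' k • x k = ∑ k, l k • x k + x i := by
          rw [hsumx]
          simp
        rw [e, hadd _ _ (hx l hl) hxi (e ▸ hx l' hl')]
        simp

end Transport

/-! ### Assembly and choice of parameters. -/

theorem card_nsmul_sub_nsmul_le {G : Type*} [AddCommGroup G] [DecidableEq G] {A : Finset G}
    (hA : A.Nonempty) {K : ℝ} (hK : ((A + A).card : ℝ) ≤ K * A.card) (m n : ℕ) :
    ((m • A - n • A).card : ℝ) ≤ K ^ (m + n) * A.card := by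
  have h := Finset.pluennecke_ruzsa_inequality_nsmul_sub_nsmul_add hA A m n
  have h' : ((m • A - n • A).card : ℝ) ≤ ((A + A).card / A.card : ℝ) ^ (m + n) * A.card := by
    have := (NNRat.cast_le (K := ℝ)).2 h
    push_cast at this
    exact this
  have hA' : (0 : ℝ) < A.card := by exact_mod_cast hA.card_pos
  refine h'.trans ?_
  gcongr
  rwa [div_le_iff₀ hA']

theorem IsMultiProgression.neg {d : ℕ} {P : Finset ℤ} (hP : IsMultiProgression d P) :
    IsMultiProgression d (-P) := by
  obtain ⟨x₀, x, L, hL, rfl⟩ := hP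
  refine ⟨-x₀, -x, L, hL, ?_⟩
  ext z
  simp only [multiProgression, Finset.mem_neg, Finset.mem_image]
  constructor
  · rintro ⟨_, ⟨l, hl, rfl⟩, rfl⟩
    refine ⟨l, hl, ?_⟩
    simp
    ring
  · rintro ⟨l, hl, rfl⟩
    refine ⟨_, ⟨l, hl, rfl⟩, ?_⟩
    simp
    ring

theorem IsMultiProgression.sub {d e : ℕ} {P Q : Finset ℤ} (hP : IsMultiProgression d P)
    (hQ : IsMultiProgression e Q) : IsMultiProgression (d + e) (P - Q) := by
  rw [sub_eq_add_neg]
  exact hP.add hQ.neg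

/-- The symmetric box `{∑ lᵢ xᵢ : |lᵢ| ≤ Lᵢ}` with distinct sums is a progression of the expected
size. -/
theorem exists_multiProgression_of_symmetric_box {d : ℕ} {x : Fin d → ℤ} {L : Fin d → ℕ}
    (hinj : ∀ l l' : Fin d → ℤ, (∀ i, |l i| ≤ L i) → (∀ i, |l' i| ≤ L i) →
      ∑ i, l i * x i = ∑ i, l' i * x i → l = l') {S : Finset ℤ}
    (hS : ∀ l : Fin d → ℤ, (∀ i, |l i| ≤ L i) → ∑ i, l i * x i ∈ S) :
    ∃ X, IsMultiProgression d X ∧ X ⊆ S ∧ X.card = ∏ i, (2 * L i + 1) := by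
  have hrw : ∀ l : Fin d → ℕ, -∑ i, L i * x i + ∑ i, (l i : ℤ) * x i
      = ∑ i, ((l i : ℤ) - L i) * x i := by
    intro l
    simp only [sub_mul, Finset.sum_sub_distrib]
    ring
  have hbox : ∀ l ∈ Fintype.piFinset fun i => Finset.range (2 * L i + 1), ∀ i,
      |((l i : ℤ) - L i)| ≤ L i := by
    intro l hl i
    have := Finset.mem_range.1 (Fintype.mem_piFinset.1 hl i)
    rw [abs_le]
    omega
  refine ⟨multiProgression (-∑ i, L i * x i) x fun i => 2 * L i + 1,
    ⟨_, _, _, fun i => by omega, rfl⟩, ?_, ?_⟩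
  · intro z hz
    obtain ⟨l, hl, rfl⟩ := Finset.mem_image.1 hz
    rw [hrw]
    exact hS _ (hbox l hl)
  · rw [multiProgression, Finset.card_image_of_injOn]
    · simp
    · intro l hl l' hl' h
      simp only [hrw] at h
      have := hinj _ _ (hbox l hl) (hbox l' hl') h
      funext i
      have := congrFun this i
      omega

/-- If `A` has doubling at most `K` then `4A - 4A` contains a large progression of small
dimension. -/
theorem exists_multiProgression_subset {A : Finset ℤ} (hA : A.Nonempty) {K : ℝ}
    (hK : ((A + A).card : ℝ) ≤ K * A.card) {k : ℕ} (hk : 0 < k)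
    (hkK : 24576 * (24 * K) ≤ k ^ 2) {ρ η : ℝ} (hρ : 0 < ρ) (hρ1 : ρ ≤ 1) (hη : 0 < η)
    (hρK : 4 * ρ ^ 2 * (24 * K) < 1) (hηρ : 2 * η ^ 4 ≤ ρ) :
    ∃ (n : ℕ) (X : Finset ℤ), IsMultiProgression (n + 1) X ∧ X ⊆ 4 • A - 4 • A ∧
      η ^ 2 * n ≤ 2 * Real.log (48 * K ^ 24 * (24 * K) ^ k) ∧
      (ρ / (7 * (n + 1 : ℕ) ^ 2 * Real.sqrt (n + 1 : ℕ))) ^ (n + 1) * A.card ≤ X.card := by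
  classical
  have hA' : (0 : ℝ) < A.card := by exact_mod_cast hA.card_pos
  have hK0 : 0 < K := by
    have h1 : (0 : ℝ) < (A + A).card := by exact_mod_cast (hA.add hA).card_pos
    by_contra! hneg
    have := mul_nonpos_of_nonpos_of_nonneg hneg hA'.le
    linarith
  obtain ⟨N, hNdef⟩ : ∃ N, N = (12 • A - 12 • A).card := ⟨_, rfl⟩
  have hNpos : 0 < N := hNdef ▸ Finset.card_pos.2 (hA.nsmul.sub hA.nsmul)
  have : NeZero N := ⟨hNpos.ne'⟩
  obtain ⟨Γ, hΓA, hΓcard, hΓ⟩ := exists_freiman_model hA (k := 12) (by norm_num) hNdef.ge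
  have hΓne : Γ.Nonempty := by
    rw [Finset.nonempty_iff_ne_empty]
    rintro rfl
    have := hA.card_pos
    rw [Finset.card_empty, mul_zero] at hΓcard
    omega
  set B := Γ.image Prod.snd
  have hBne : B.Nonempty := hΓne.image _
  have hBcard : B.card = Γ.card := Finset.card_image_of_injOn fun z hz z' hz' h => by
    have h1 : z ∈ 1 • Γ := by rwa [one_nsmul]
    have h2 : z' ∈ 1 • Γ := by rwa [one_nsmul]
    exact Prod.ext ((fst_eq_iff_snd_eq_of_freiman hΓne (by norm_num) hΓ h1 h2).2 h) h
  have hAB : (A.card : ℝ) ≤ 24 * B.card := by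
    rw [hBcard]
    exact_mod_cast hΓcard
  have hB' : (0 : ℝ) < B.card := by exact_mod_cast hBne.card_pos
  have hΓ2 : ∀ z ∈ Γ + Γ, z ∈ 2 • Γ := fun z hz => by rwa [two_nsmul]
  have hBB : (B + B).card ≤ (A + A).card := by
    have h1 : B + B ⊆ (Γ + Γ).image Prod.snd := by
      intro y hy
      obtain ⟨a, ha, b, hb, rfl⟩ := Finset.mem_add.1 hy
      obtain ⟨z, hz, rfl⟩ := Finset.mem_image.1 ha
      obtain ⟨w, hw, rfl⟩ := Finset.mem_image.1 hb
      exact Finset.mem_image.2 ⟨z + w, Finset.add_mem_add hz hw, rfl⟩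
    refine (Finset.card_le_card h1).trans (Finset.card_image_le.trans ?_)
    refine Finset.card_le_card_of_injOn Prod.fst ?_ ?_
    · intro z hz
      obtain ⟨a, ha, b, hb, rfl⟩ := Finset.mem_add.1 hz
      exact Finset.add_mem_add (hΓA a ha) (hΓA b hb)
    · intro z hz z' hz' h
      exact Prod.ext h
        ((fst_eq_iff_snd_eq_of_freiman hΓne (by norm_num) hΓ (hΓ2 z hz) (hΓ2 z' hz')).1 h)
  have hBK : ((B + B).card : ℝ) ≤ 24 * K * B.card := by
    calc ((B + B).card : ℝ) ≤ (A + A).card := by exact_mod_cast hBB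
      _ ≤ K * A.card := hK
      _ ≤ K * (24 * B.card) := by gcongr
      _ = _ := by ring
  obtain ⟨T, hTB, hTcard, hper⟩ := exists_almostPeriods hBne hBK hk hkK
  have hTne : T.Nonempty := by
    rw [Finset.nonempty_iff_ne_empty]
    rintro rfl
    simp at hTcard
    exact hBne.ne_empty hTcard
  have hT' : (0 : ℝ) < T.card := by exact_mod_cast hTne.card_pos
  obtain ⟨Λ, hΛcard, hΛ⟩ := exists_bohr_subset hTB hTne hBK hper hρ hη hρK hηρ
  set n := Λ.card
  have hn0 : (0 : ℝ) < (n + 1 : ℕ) := by positivity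
  set d : ℝ := ((n + 1 : ℕ) : ℝ) with hd
  have hd1 : 1 ≤ d := by rw [hd]; push_cast; linarith [(Nat.cast_nonneg n : (0 : ℝ) ≤ n)]
  -- In the radius `ρ / (7 d)`, `d` absorbs the factor `|Λ|` of the Bohr condition and `7 > 2π`
  -- absorbs the passage from residues to characters.
  have hρ2 : ρ / (7 * d) < 1 / 2 := by
    rw [div_lt_iff₀ (by positivity)]
    linarith
  obtain ⟨x, L, hx1, hx2, hx3⟩ := exists_progression_of_addChars Λ (ρ := ρ / (7 * d))
    (by positivity) hρ2
  have hcast : ∀ l : Fin (n + 1) → ℤ, ((∑ i, l i * x i : ℤ) : ZMod N)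
      = ∑ i, l i • (x i : ZMod N) := by
    intro l
    push_cast
    simp only [zsmul_eq_mul]
  obtain ⟨x', hx'⟩ := exists_lift_progression (x := fun i => (x i : ZMod N)) (L := L) hΓne hΓ
    (fun l hl => by
      rw [← hcast]
      refine hΛ _ fun ψ hψ => ?_
      calc (n : ℝ) * ‖1 - ψ ((∑ i, l i * x i : ℤ) : ZMod N)‖
          ≤ d * (2 * Real.pi * (ρ / (7 * d))) := by
            gcongr
            · rw [hd]; push_cast; linarith
            · exact hx1 l hl ψ hψ
        _ = 2 * Real.pi / 7 * ρ := by field_simp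
        _ ≤ 1 * ρ := by
            gcongr
            linarith [Real.pi_lt_d2]
        _ = ρ := one_mul ρ)
  have hΓA4 : (4 • Γ - 4 • Γ).image Prod.fst ⊆ 4 • A - 4 • A := by
    have h1 : Γ.image (AddMonoidHom.fst ℤ (ZMod N)) ⊆ A := by
      intro a ha
      obtain ⟨z, hz, rfl⟩ := Finset.mem_image.1 ha
      exact hΓA z hz
    have h2 : (4 • Γ - 4 • Γ).image (AddMonoidHom.fst ℤ (ZMod N))
        = 4 • Γ.image (AddMonoidHom.fst ℤ (ZMod N)) - 4 • Γ.image (AddMonoidHom.fst ℤ (ZMod N)) := by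
      rw [show (4 • Γ - 4 • Γ).image (AddMonoidHom.fst ℤ (ZMod N)) = _ from
        Finset.image_image₂_distrib (map_sub (AddMonoidHom.fst ℤ (ZMod N))), Finset.image_nsmul]
      rfl
    refine h2.le.trans ?_
    exact Finset.sub_subset_sub (Finset.nsmul_subset_nsmul_left h1)
      (Finset.nsmul_subset_nsmul_left h1)
  obtain ⟨X, hX, hXA, hXcard⟩ := exists_multiProgression_of_symmetric_box (x := x') (L := L)
    (S := 4 • A - 4 • A)
    (fun l l' hl hl' heq => by
      obtain ⟨z, hz, hz2, hz1⟩ := hx' l hl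
      obtain ⟨z', hz', hz2', hz1'⟩ := hx' l' hl'
      -- Equal sums in `ℤ` thus have equal images in `ZMod N`, where the progression is proper.
      have hmem : z - z' ∈ 12 • Γ - 12 • Γ := by
        refine Finset.nsmul_sub_nsmul_mono hΓne (by norm_num : 8 ≤ 12) ?_
        obtain ⟨a, ha, b, hb, rfl⟩ := Finset.mem_sub.1 hz
        obtain ⟨a', ha', b', hb', rfl⟩ := Finset.mem_sub.1 hz'
        rw [show a - b - (a' - b') = (a + b') - (b + a') by abel,
          show 8 • Γ = 4 • Γ + 4 • Γ by rw [← add_nsmul]]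
        exact Finset.sub_mem_sub (Finset.add_mem_add ha hb') (Finset.add_mem_add hb ha')
      have h0 := (hΓ _ hmem).1 (by
        rw [Prod.fst_sub, hz1, hz1', sub_eq_zero]
        simpa only [smul_eq_mul] using heq)
      refine hx2 l l' hl hl' ?_
      rw [hcast, hcast, ← hz2, ← hz2']
      exact sub_eq_zero.1 (by rwa [Prod.snd_sub] at h0))
    (fun l hl => by
      obtain ⟨z, hz, -, hz1⟩ := hx' l hl
      refine hΓA4 (Finset.mem_image.2 ⟨z, hz, ?_⟩)
      simpa only [smul_eq_mul] using hz1)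
  refine ⟨n, X, hX, hXA, ?_, ?_⟩
  · refine hΛcard.trans ?_
    rw [ZMod.card]
    have hN : (N : ℝ) ≤ K ^ 24 * A.card := by
      rw [hNdef]
      exact card_nsmul_sub_nsmul_le hA hK 12 12
    have hNT : (N : ℝ) / T.card ≤ 48 * K ^ 24 * (24 * K) ^ k := by
      rw [div_le_iff₀ hT']
      calc (N : ℝ) ≤ K ^ 24 * A.card := hN
        _ ≤ K ^ 24 * (24 * B.card) := by gcongr
        _ ≤ K ^ 24 * (24 * (2 * (24 * K) ^ k * T.card)) := by gcongr
        _ = _ := by ring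
    have hN' : (0 : ℝ) < N := by exact_mod_cast hNpos
    exact mul_le_mul_of_nonneg_left (Real.log_le_log (by positivity) hNT) zero_le_two
  · have hAN : (A.card : ℝ) ≤ N := by
      have h1 : A.card ≤ (1 • A - 0 • A).card := by simp
      have h2 : (1 • A - 0 • A).card ≤ (12 • A - 12 • A).card := by
        obtain ⟨c, hc⟩ := hA.nsmul (n := 11)
        obtain ⟨e, he⟩ := hA.nsmul (n := 12)
        refine Finset.card_le_card_of_injOn (fun z => z + (c - e)) ?_ fun a _ b _ h => by
          simpa using h
        intro z hz
        simp only [one_nsmul, zero_nsmul, sub_zero, Finset.mem_coe] at hz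
        have h3 : z + c ∈ 12 • A := by
          rw [show 12 • A = 1 • A + 11 • A by rw [← add_nsmul], one_nsmul]
          exact Finset.add_mem_add hz hc
        have := Finset.sub_mem_sub h3 he
        rwa [add_sub_assoc] at this
      rw [hNdef]
      exact_mod_cast h1.trans h2
    have hcardX : (X.card : ℝ) = ∏ i, (2 * L i + 1 : ℝ) := by
      rw [hXcard]
      push_cast
      rfl
    rw [hcardX]
    refine le_trans ?_ hx3
    rw [div_div, show 7 * d * (d * Real.sqrt d) = 7 * d ^ 2 * Real.sqrt d by ring]
    have h0 : 0 ≤ 7 * d ^ 2 * Real.sqrt d := by positivity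
    exact mul_le_mul_of_nonneg_left hAN (pow_nonneg (div_nonneg hρ.le h0) _)

theorem Real.log_natCast_mul_pow_le {a K : ℝ} (ha : 1 ≤ a) (hK : K = a ^ 4)
    (hℓ : 1 / 3 ≤ Real.log K) {k : ℕ} (hk : (k : ℝ) ≤ 801 * a ^ 2) :
    Real.log (48 * K ^ 24 * (24 * K) ^ k) ≤ 60000 * (a ^ 2 * Real.log K) := by
  have hK0 : 0 < K := by rw [hK]; positivity
  rw [Real.log_mul (by positivity) (by positivity), Real.log_mul (by norm_num) (by positivity),
    Real.log_pow, Real.log_pow, Real.log_mul (by norm_num) hK0.ne']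
  have h1 : Real.log 48 ≤ 48 - 1 := Real.log_le_sub_one_of_pos (by norm_num)
  have h2 : Real.log 24 ≤ 24 - 1 := Real.log_le_sub_one_of_pos (by norm_num)
  set l := Real.log K
  have ha2 : 1 ≤ a ^ 2 := one_le_pow₀ ha
  have h3 : l ≤ a ^ 2 * l := le_mul_of_one_le_left (by linarith) ha2
  have h4 : (k : ℝ) * (Real.log 24 + l) ≤ 801 * a ^ 2 * (70 * l) := by
    gcongr
    linarith
  push_cast
  linarith

/-- The dimension `d` is polynomial in `K`, so the loss per dimension is only a power of `K`. -/
theorem Real.log_scale_le {a K d : ℝ} (ha : 1 ≤ a) (hK : K = a ^ 4) (hℓ : 1 / 3 ≤ Real.log K)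
    (hd : 1 ≤ d) (hda : d ≤ 2000000 * (a ^ 3 * Real.log K)) :
    Real.log (70 * a ^ 2 * (d ^ 2 * Real.sqrt d)) ≤ 403 * Real.log K := by
  have hK0 : 0 < K := by rw [hK]; positivity
  have hd0 : 0 < d := by linarith
  have hlK : Real.log K ≤ K := by linarith [Real.log_le_sub_one_of_pos hK0]
  have hlogd : Real.log d ≤ 65 * Real.log K := by
    have h1 : d ≤ 2 ^ 21 * K ^ 2 := by
      calc d ≤ 2000000 * (a ^ 3 * Real.log K) := hda
        _ ≤ 2000000 * (a ^ 4 * K) := by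
            gcongr
            norm_num
        _ ≤ 2 ^ 21 * (a ^ 4 * K) := by
            gcongr
            norm_num
        _ = _ := by rw [← hK]; ring
    have h2 := Real.log_le_log hd0 h1
    rw [Real.log_mul (by positivity) (by positivity), Real.log_pow, Real.log_pow] at h2
    push_cast at h2
    linarith [Real.log_two_lt_d9]
  have hsq : Real.sqrt d ≤ d := Real.sqrt_le_self_iff.2 (.inr hd)
  have hle : 70 * a ^ 2 * (d ^ 2 * Real.sqrt d) ≤ 70 * K * d ^ 3 := by
    calc 70 * a ^ 2 * (d ^ 2 * Real.sqrt d) ≤ 70 * a ^ 4 * (d ^ 2 * d) := by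
          gcongr
          norm_num
      _ = _ := by rw [hK]; ring
  have hs0 : 0 < Real.sqrt d := Real.sqrt_pos.2 hd0
  have h := Real.log_le_log (by positivity) hle
  have h2 : Real.log (70 * K * d ^ 3) = Real.log 70 + Real.log K + 3 * Real.log d := by
    rw [Real.log_mul (by positivity) (by positivity), Real.log_mul (by norm_num) hK0.ne',
      Real.log_pow]
    norm_num
  have h1 : Real.log 70 ≤ 70 - 1 := Real.log_le_sub_one_of_pos (by norm_num)
  linarith

/-- Freiman's theorem for sets of doubling at most `K` with `K` bounded away from `1`. -/
theorem exists_multiProgression_superset {A : Finset ℤ} (hA : A.Nonempty) {K a : ℝ}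
    (hK : ((A + A).card : ℝ) ≤ K * A.card) (ha : 1 ≤ a) (hKa : K = a ^ 4)
    (hℓ : 1 / 3 ≤ Real.log K) :
    ∃ (d : ℕ) (P : Finset ℤ), IsMultiProgression d P ∧ A ⊆ P ∧
      (d : ℝ) ≤ 6000000000 * (a ^ 7 * Real.log K ^ 2) ∧
      (P.card : ℝ) ≤ Real.exp (20000000000 * (a ^ 7 * Real.log K ^ 2)) * A.card := by
  have ha0 : 0 < a := by linarith
  have hK0 : 0 < K := by rw [hKa]; positivity
  have hK1 : 1 ≤ K := by rw [hKa]; exact one_le_pow₀ ha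
  have hA' : (0 : ℝ) < A.card := by exact_mod_cast hA.card_pos
  set l := Real.log K
  have hl0 : 0 < l := by linarith
  have ha2 : 1 ≤ a ^ 2 := one_le_pow₀ ha
  have hk : ((⌈800 * a ^ 2⌉₊ : ℕ) : ℝ) ≤ 801 * a ^ 2 := by
    have := (Nat.ceil_lt_add_one (by positivity : 0 ≤ 800 * a ^ 2)).le
    linarith
  have hk' : 800 * a ^ 2 ≤ ((⌈800 * a ^ 2⌉₊ : ℕ) : ℝ) := Nat.le_ceil _
  set k := ⌈800 * a ^ 2⌉₊
  have hsa : Real.sqrt a ^ 2 = a := Real.sq_sqrt ha0.le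
  have hsa0 : 0 < Real.sqrt a := Real.sqrt_pos.2 ha0
  -- With `a = K^(1/4)`: `k` is about `K^(1/2)`, `ρ` about `K^(-1/2)` and `η` about `K^(-1/8)`. Then
  -- `n` is at most of order `η⁻² k log K`, or `a³ log K`.
  obtain ⟨n, X, hX, hXA, hn, hXcard⟩ := exists_multiProgression_subset hA hK (k := k)
    (ρ := 1 / (10 * a ^ 2)) (η := 1 / (3 * Real.sqrt a))
    (Nat.ceil_pos.2 (by positivity))
    (by
      calc 24576 * (24 * K) ≤ (800 * a ^ 2) ^ 2 := by rw [hKa]; nlinarith [pow_pos ha0 4]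
        _ ≤ _ := by gcongr)
    (by positivity)
    (by rw [div_le_one (by positivity)]; linarith) (by positivity)
    (by
      rw [hKa, div_pow, mul_pow, ← pow_mul]
      field_simp
      norm_num
      linarith [pow_pos ha0 4])
    (by
      rw [div_pow, mul_pow, show Real.sqrt a ^ 4 = (Real.sqrt a ^ 2) ^ 2 by ring, hsa]
      field_simp
      norm_num)
  rw [div_pow, mul_pow, hsa] at hn
  set d : ℝ := ((n + 1 : ℕ) : ℝ) with hd
  have hdn : d = n + 1 := by rw [hd]; push_cast; ring
  have hd1 : 1 ≤ d := by rw [hdn]; linarith [(Nat.cast_nonneg n : (0 : ℝ) ≤ n)]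
  have hal : 1 ≤ 3 * (a ^ 3 * l) := by
    have : 1 * (1 / 3) ≤ a ^ 3 * l := by
      gcongr
      exact one_le_pow₀ ha
    linarith
  have hda : d ≤ 2000000 * (a ^ 3 * l) := by
    have h1 := hn.trans (mul_le_mul_of_nonneg_left
      (Real.log_natCast_mul_pow_le ha hKa hℓ hk) zero_le_two)
    have h2 : (n : ℝ) = 9 * a * (1 ^ 2 / (3 ^ 2 * a) * n) := by field_simp; norm_num
    have h3 : (n : ℝ) ≤ 9 * a * (2 * (60000 * (a ^ 2 * l))) := by
      rw [h2]
      gcongr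
    have h4 : 9 * a * (2 * (60000 * (a ^ 2 * l))) = 1080000 * (a ^ 3 * l) := by ring
    rw [hdn]
    linarith
  set W := 70 * a ^ 2 * (d ^ 2 * Real.sqrt d) with hW
  have hsd : 0 < Real.sqrt d := Real.sqrt_pos.2 (by linarith)
  have hW0 : 0 < W := by positivity
  have hlogW : Real.log W ≤ 403 * l := Real.log_scale_le ha hKa hℓ hd1 hda
  have hXW : (A.card : ℝ) ≤ W ^ (n + 1) * X.card := by
    rw [show 1 / (10 * a ^ 2) / (7 * d ^ 2 * Real.sqrt d) = W⁻¹ by rw [hW]; field_simp; norm_num,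
      inv_pow, inv_mul_le_iff₀ (by positivity)] at hXcard
    exact hXcard
  have hX0 : (0 : ℝ) < X.card := by
    by_contra! hneg
    have := mul_nonpos_of_nonneg_of_nonpos (pow_pos hW0 (n + 1)).le hneg
    linarith
  have hXne : X.Nonempty := Finset.card_pos.1 (by exact_mod_cast hX0)
  have hm : 2 * K ≤ ((⌈2 * K⌉₊ : ℕ) : ℝ) := Nat.le_ceil _
  have hm' : ((⌈2 * K⌉₊ : ℕ) : ℝ) ≤ 3 * a ^ 4 := by
    have := (Nat.ceil_lt_add_one (by positivity : 0 ≤ 2 * K)).le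
    rw [← hKa]
    linarith
  set m := ⌈2 * K⌉₊
  obtain ⟨t, P, ht, hP, hPcard, hAP⟩ := chang_covering (A := A) hXne hK0 (M := K ^ 8 * A.card)
    (fun t => by
      have hsub : t • A + X ⊆ (t + 4) • A - 4 • A := by
        refine (Finset.add_subset_add_left hXA).trans ?_
        rw [← add_sub_assoc, ← add_nsmul]
      calc ((t • A + X).card : ℝ) ≤ ((t + 4) • A - 4 • A).card := by
            exact_mod_cast Finset.card_le_card hsub
        _ ≤ K ^ (t + 4 + 4) * A.card := card_nsmul_sub_nsmul_le hA hK _ _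
        _ = _ := by ring) hm
  have ha3 : 1 ≤ a ^ 3 := one_le_pow₀ ha
  have hl2 : l ≤ 3 * l ^ 2 := by nlinarith
  have hal2 : l ^ 2 ≤ a ^ 3 * l ^ 2 := le_mul_of_one_le_left (by positivity) ha3
  -- From `2^t ≤ K^8 W^d`, the number of rounds is of order `d log W`.
  have htle : (t : ℝ) + 1 ≤ 1800000000 * (a ^ 3 * l ^ 2) := by
    have h1 : (2 : ℝ) ^ t ≤ K ^ 8 * W ^ (n + 1) := by
      refine le_of_mul_le_mul_right (ht.trans ?_) hX0
      calc K ^ 8 * A.card ≤ K ^ 8 * (W ^ (n + 1) * X.card) := by gcongr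
        _ = _ := by ring
    have h2 := Real.log_le_log (by positivity) h1
    rw [Real.log_mul (by positivity) (by positivity), Real.log_pow, Real.log_pow, Real.log_pow,
      ← hd] at h2
    push_cast at h2
    have h3 : d * Real.log W ≤ 2000000 * (a ^ 3 * l) * (403 * l) := by
      calc d * Real.log W ≤ d * (403 * l) := by gcongr
        _ ≤ _ := by gcongr
    have h4 : (t : ℝ) * (1 / 2) ≤ t * Real.log 2 := by
      gcongr
      linarith [Real.log_two_gt_d9]
    have h5 : 2000000 * (a ^ 3 * l) * (403 * l) = 806000000 * (a ^ 3 * l ^ 2) := by ring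
    have h6 : 1 ≤ 9 * l ^ 2 := by nlinarith
    linarith
  have hmt : (m : ℝ) * (t + 1) ≤ 5400000000 * (a ^ 7 * l ^ 2) := by
    calc (m : ℝ) * (t + 1) ≤ 3 * a ^ 4 * (1800000000 * (a ^ 3 * l ^ 2)) := by gcongr
      _ = _ := by ring
  have ha37 : a ^ 3 ≤ a ^ 7 := pow_le_pow_right₀ ha (by norm_num)
  have ha7 : 1 ≤ a ^ 7 := one_le_pow₀ ha
  refine ⟨m * (t + 1) + ((n + 1) + (n + 1)), P + (X - X), hP.add (hX.sub hX), hAP, ?_, ?_⟩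
  · have h1 : a ^ 3 * l ≤ a ^ 7 * (3 * l ^ 2) := by gcongr
    push_cast
    linarith
  · have h3 : (3 : ℝ) ≤ Real.exp 2 := by linarith [Real.add_one_le_exp (2 : ℝ)]
    have hXX : ((X - X).card : ℝ) ≤ K ^ 16 * A.card := by
      have hsub : X - X ⊆ 8 • A - 8 • A := by
        refine (Finset.sub_subset_sub hXA hXA).trans ?_
        rw [sub_sub_eq_add_sub, sub_add_eq_add_sub, sub_sub, ← add_nsmul]
      calc ((X - X).card : ℝ) ≤ (8 • A - 8 • A).card := by exact_mod_cast Finset.card_le_card hsub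
        _ ≤ _ := card_nsmul_sub_nsmul_le hA hK 8 8
    have hK16 : K ^ 16 = Real.exp (16 * l) := by
      rw [show (16 : ℝ) * l = ((16 : ℕ) : ℝ) * Real.log K by norm_num [l], Real.exp_nat_mul,
        Real.exp_log hK0]
    calc ((P + (X - X)).card : ℝ) ≤ P.card * (X - X).card := by exact_mod_cast Finset.card_add_le
      _ ≤ (3 : ℝ) ^ (m * (t + 1)) * (K ^ 16 * A.card) := by
          gcongr
          exact_mod_cast hPcard
      _ ≤ Real.exp 2 ^ (m * (t + 1)) * (K ^ 16 * A.card) := by gcongr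
      _ = Real.exp ((m * (t + 1)) * 2 + 16 * l) * A.card := by
          rw [hK16, ← Real.exp_nat_mul, ← mul_assoc, ← Real.exp_add]
          push_cast
          rfl
      _ ≤ _ := by
          gcongr
          have h1 : l ≤ a ^ 7 * (3 * l ^ 2) := hl2.trans (le_mul_of_one_le_left (by positivity) ha7)
          linarith

/-- From `|A + A| ≥ 2|A| - 1`. This keeps `log K` away from 0, so that additive constants can be
absorbed. -/
theorem three_halves_le_of_two_le_card {A : Finset ℤ} {K : ℝ} (hA : 2 ≤ A.card)
    (hK : ((A + A).card : ℝ) ≤ K * A.card) : 3 / 2 ≤ K := by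
  have hne : A.Nonempty := Finset.card_pos.1 (by omega)
  have h := cauchy_davenport_add_of_linearOrder_isCancelAdd hne hne
  have h1 : (3 : ℝ) * A.card ≤ 2 * (A + A).card := by exact_mod_cast (by omega)
  have hA' : (0 : ℝ) < A.card := by exact_mod_cast hne.card_pos
  refine le_of_mul_le_mul_right ?_ hA'
  linarith

theorem theorem1p1 :
    ∃ C : ℝ, 0 < C ∧
      ∀ (A : Finset ℤ) (K : ℝ), A.Nonempty →
        ((A + A).card : ℝ) ≤ K * (A.card : ℝ) →
        ∃ (d : ℕ) (P : Finset ℤ), IsMultiProgression d P ∧ A ⊆ P ∧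
          (d : ℝ) ≤ C * (K ^ (7 / 4 : ℝ) * Real.log K ^ 3) ∧
          (P.card : ℝ) ≤
            Real.exp (C * (K ^ (7 / 4 : ℝ) * Real.log K ^ 3)) * (A.card : ℝ) := by
  refine ⟨60000000000, by norm_num, fun A K hA hK => ?_⟩
  rcases le_or_gt 2 A.card with h2 | h1
  · have hK32 := three_halves_le_of_two_le_card h2 hK
    have hK0 : 0 < K := by linarith
    have hℓ : 1 / 3 ≤ Real.log K := by
      have h := Real.one_sub_inv_le_log_of_pos hK0
      have : K⁻¹ ≤ (3 / 2)⁻¹ := by gcongr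
      norm_num at this
      linarith
    have hpow : ∀ n : ℕ, (K ^ (1 / 4 : ℝ)) ^ n = K ^ ((n : ℝ) / 4) := fun n => by
      rw [← Real.rpow_natCast, ← Real.rpow_mul hK0.le]
      ring_nf
    have h4 : K = (K ^ (1 / 4 : ℝ)) ^ 4 := by
      rw [hpow]
      norm_num
    have h7 : (K ^ (1 / 4 : ℝ)) ^ 7 = K ^ (7 / 4 : ℝ) := by
      rw [hpow]
      norm_num
    obtain ⟨d, P, hP, hAP, hd, hc⟩ := exists_multiProgression_superset hA hK
      (Real.one_le_rpow (by linarith) (by norm_num)) h4 hℓ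
    rw [h7] at hd hc
    -- The square suffices; raising it to the cube costs a factor 3 because `log K ≥ 1/3`.
    have hl : Real.log K ^ 2 ≤ 3 * Real.log K ^ 3 := by nlinarith [sq_nonneg (Real.log K)]
    have hy : 0 ≤ K ^ (7 / 4 : ℝ) := Real.rpow_nonneg hK0.le _
    have hle : K ^ (7 / 4 : ℝ) * Real.log K ^ 2 ≤ 3 * (K ^ (7 / 4 : ℝ) * Real.log K ^ 3) := by
      rw [mul_left_comm]
      exact mul_le_mul_of_nonneg_left hl hy
    have h0 : 0 ≤ K ^ (7 / 4 : ℝ) * Real.log K ^ 2 := by positivity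
    refine ⟨d, P, hP, hAP, by linarith, hc.trans ?_⟩
    exact mul_le_mul_of_nonneg_right (Real.exp_le_exp.2 (by linarith)) (Nat.cast_nonneg _)
  -- For a singleton `K` may equal 1 and both bounds degenerate, so dimension 0 is used.
  · have hA1 : A.card = 1 := by
      have := hA.card_pos
      omega
    obtain ⟨x, rfl⟩ := Finset.card_eq_one.1 hA1
    have hK1 : 1 ≤ K := by simpa using hK
    have hnonneg : 0 ≤ 60000000000 * (K ^ (7 / 4 : ℝ) * Real.log K ^ 3) := by
      have := Real.log_nonneg hK1
      positivity
    refine ⟨0, {x}, ⟨x, Fin.elim0, Fin.elim0, fun i => i.elim0, by simp [multiProgression]⟩,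
      subset_rfl, by rwa [Nat.cast_zero], ?_⟩
    rw [Finset.card_singleton, Nat.cast_one, mul_one]
    exact Real.one_le_exp hnonneg
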